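/- Let $N\ge 1$ with $4\mid N$ and let $k\in\{\tfrac32,\tfrac52,\tfrac72,\dots\}$. For $\kappa\in\frac12+\mathbb Z$, $\gamma=\begin{pmatrix}a&b\\c&d\end{pmatrix}\in\Gamma_0(N)$ and a function $g$ on the upper half-plane $\mathbb H$ put $$(g|_\kappa\gamma)(z)=\varepsilon_d^{2\kappa}\left(\tfrac cd\right)(cz+d)^{-\kappa}\,g\!\left(\tfrac{az+b}{cz+d}\right),$$ where $\left(\tfrac{\cdot}{\cdot}\right)$ is the Kronecker symbol, $\varepsilon_d=1$ if $d\equiv1\pmod 4$, $\varepsilon_d=i$ if $d\equiv3\pmod 4$, and powers are principal. Let $f$ be a cusp form of weight $k$ for $\Gamma_0(N)$, i.e. a holomorphic function on $\mathbb H$ with $f|_k\gamma=f$ for all $\gamma\in\Gamma_0(N)$ that decays exponentially at every cusp (for every $\begin{pmatrix}a'&b'\\c'&d'\end{pmatrix}\in\mathrm{SL}_2(\mathbb Z)$ there is $\delta>0$ with $(c'z+d')^{-k}f\big(\tfrac{a'z+b'}{c'z+d'}\big)=O(e^{-\delta\,\mathrm{Im} z})$ as $\mathrm{Im} z\to\infty$).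 Write $f=\sum_{n\ge1}a_nq^n$, $q=e^{2\pi iz}$, and let $$\tilde f(z)=\sum_{n\ge1}a_nn^{1-k}q^n$$ be its Eichler integral. For $\gamma=\begin{pmatrix}a&b\\c&d\end{pmatrix}\in\Gamma_0(N)$ let $\chi_{-4}(d)=\left(\tfrac{-4}{d}\right)$, and let $$\tilde h_\gamma=\tilde f-\chi_{-4}(d)\,\tilde f|_{2-k}\gamma,\qquad \mathbb C_\gamma=\{z\in\mathbb C: cz+d\notin\mathbb R_{\le0}\}.$$ Then $\tilde f$ is holomorphic on $\mathbb H$, and for every $\gamma\in\Gamma_0(N)$: 1. There is an analytic function on $\mathbb C_\gamma$, again denoted $\tilde h_\gamma$, that agrees with $\tilde h_\gamma$ on $\mathbb H\cap\mathbb C_\gamma$. 2. If $c\ne0$, then for every $z\in\mathbb C_\gamma$ $$\tilde h_\gamma(z)=\frac{(-2\pi i)^{k-1}}{\Gamma(k-1)}\int_{-d/c}^{i\infty}f(\tau)(\tau-z)^{k-2}\,d\tau ,$$ where $(-2\pi i)^{k-1}$ is principal, the branch of $(\tau-z)^{k-2}$ is the one with branch cut (in $\tau$) $z+\mathbb R_{\ge0}$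 and $0<\arg(\tau-z)<2\pi$ if $c>0$, and with branch cut $z+\mathbb R_{\le0}$ and $-\pi<\arg(\tau-z)<\pi$ if $c<0$. Here the path of integration is any piecewise $C^1$ path in $\mathbb H$ from $-d/c$ to $i\infty$ that avoids this branch cut and is contained near each of its two end points in a cone $|\mathrm{Re}(\tau)-x|\le M\,\mathrm{Im}(\tau)$ (with $x=-d/c$ near the starting point, and $x=0$ near $i\infty$); such paths exist, and the improper integral converges along each of them. If $c=0$ (so that $-d/c$ is to be read as $i\infty$ and the integral as $0$), then $\tilde h_\gamma=0$ on $\mathbb C_\gamma$. -/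

import Mathlib

open scoped MatrixGroups Topology Manifold

noncomputable section

namespace HalfIntegral

/-- The Kronecker symbol `(a/n)` for arbitrary integers: completely multiplicative in `n`, with
value `-1` at `n = -1` iff `a < 0`, `(a/2) = 0, 1, -1` according to `a` even, `a ≡ ±1`, `a ≡ ±3` mod `8`,
the Legendre symbol at odd primes, and `(a/0) = 1` if `a = ±1` and `0` otherwise. -/
def kronecker (a n : ℤ) : ℤ :=
  if n = 0 then (if a.natAbs = 1 then 1 else 0)
  else (if n < 0 ∧ a < 0 then -1 else 1) * ZMod.χ₈ (a : ZMod 8) ^ padicValNat 2 n.natAbs *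
    jacobiSym a (n.natAbs / 2 ^ padicValNat 2 n.natAbs)

/-- `ε_d`, equal to `1` if `d ≡ 1 mod 4` and to `i` if `d ≡ 3 mod 4` (only used for odd `d`). -/
def epsilonFactor (d : ℤ) : ℂ := if d % 4 = 1 then 1 else Complex.I

/-- The automorphy factor `c z + d`. -/
def autFactor (γ : SL(2, ℤ)) (z : ℂ) : ℂ := (γ 1 0 : ℂ) * z + (γ 1 1 : ℂ)

/-- The slash operator of half-integral weight `κ ∈ 1/2 + ℤ`,
`(f|_κ γ)(z) = ε_d^{2κ} (c/d) (cz+d)^{-κ} f(γ z)`, with principal powers. -/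
def slash (κ : ℝ) (γ : SL(2, ℤ)) (f : UpperHalfPlane → ℂ) (z : UpperHalfPlane) : ℂ :=
  epsilonFactor (γ 1 1) ^ ((2 * κ : ℝ) : ℂ) * (kronecker (γ 1 0) (γ 1 1) : ℂ) *
    autFactor γ z ^ ((-κ : ℝ) : ℂ) * f (γ • z)

/-- Cusp forms of half-integral weight `k` for `Γ₀(N)`, `4 ∣ N`: holomorphic, invariant under the
slash operator, exponentially decaying at every cusp `α(i∞)`, `α ∈ SL₂(ℤ)`. -/
structure IsCuspForm (N : ℕ) (k : ℝ) (f : UpperHalfPlane → ℂ) : Prop where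
  holo : MDifferentiable 𝓘(ℂ) 𝓘(ℂ) f
  slash_eq : ∀ γ ∈ CongruenceSubgroup.Gamma0 N, ∀ z, f z = slash k γ f z
  decay : ∀ α : SL(2, ℤ), ∃ δ : ℝ, 0 < δ ∧
    (fun z : UpperHalfPlane => autFactor α z ^ ((-k : ℝ) : ℂ) * f (α • z))
      =O[UpperHalfPlane.atImInfty] fun z => Real.exp (-δ * z.im)

/-- The Eichler integral `∑_{n ≥ 1} a_n n^{1-k} q^n`, where `f = ∑_{n ≥ 1} a_n q^n`,
`q = e^{2πiz}`. -/
def eichlerIntegral (k : ℝ) (f : UpperHalfPlane → ℂ) (z : UpperHalfPlane) : ℂ :=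
  ∑' n : ℕ, (UpperHalfPlane.qExpansion 1 f).coeff (n + 1) *
    ((n + 1 : ℕ) : ℂ) ^ ((1 - k : ℝ) : ℂ) *
    Complex.exp (2 * Real.pi * Complex.I * ((n + 1 : ℕ) : ℂ) * z)

/-- The obstruction to modularity `f̃ - χ_{-4}(d) f̃|_{2-k} γ`, where `χ_{-4} = (-4/·)`. -/
def obstruction (k : ℝ) (f : UpperHalfPlane → ℂ) (γ : SL(2, ℤ)) (z : UpperHalfPlane) : ℂ :=
  eichlerIntegral k f z -
    (kronecker (-4) (γ 1 1) : ℂ) * slash (2 - k) γ (eichlerIntegral k f) z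

/-- The cut plane `ℂ_γ = {z : cz + d ∈ ℂ \ ℝ_{≤ 0}}`. -/
def cutPlane (γ : SL(2, ℤ)) : Set ℂ := {z | autFactor γ z ∈ Complex.slitPlane}

/-- The branch cut, in the variable `τ`, of `(τ - z)^s`: the horizontal ray which starts at `z` and
runs to the right if `c > 0`, to the left if `c < 0`. For `c ≠ 0`, the set of `z` for which `-d/c`
does not lie on it is exactly `cutPlane γ`. -/
def branchCut (c : ℤ) (z : ℂ) : Set ℂ := {τ | ∃ t : ℝ, 0 ≤ t ∧ τ = z + (c.sign : ℂ) * t}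

/-- The branch of `w^s` on `ℂ \ ℝ_{≥ 0}` with `arg w ∈ (0, 2π)` if `c > 0`, and the principal branch
on `ℂ \ ℝ_{≤ 0}` otherwise. Both are the principal power for `w` in the upper half-plane. -/
def branchPow (c : ℤ) (w s : ℂ) : ℂ :=
  if 0 < c then Complex.exp (Real.pi * Complex.I * s) * (-w) ^ s else w ^ s

/-- `p` restricted to `(0, ∞)` is a (generalized piecewise `C¹`) path in the upper half-plane from
`-d/c` to `i∞` which avoids the branch cut of `(τ - z)^s`. As usual for paths between cusps, both
end points are approached inside a vertical cone. -/
structure IsAdmissiblePath (γ : SL(2, ℤ)) (z : ℂ) (p : ℝ → ℂ) : Prop where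
  cont : ContinuousOn p (Set.Ioi 0)
  diff : ∃ S : Set ℝ, S.Countable ∧ ∀ t : ℝ, 0 < t → t ∉ S → DifferentiableAt ℝ p t
  deriv_int : MeasureTheory.LocallyIntegrableOn (deriv p) (Set.Ioi 0)
  im_pos : ∀ t : ℝ, 0 < t → 0 < (p t).im
  avoids : ∀ t : ℝ, 0 < t → p t ∉ branchCut (γ 1 0) z
  start : Filter.Tendsto p (𝓝[>] 0) (𝓝 (-(γ 1 1 : ℂ) / (γ 1 0 : ℂ)))
  start_cone : ∃ M : ℝ, ∀ᶠ t in 𝓝[>] (0 : ℝ),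
    |(p t).re - (-(γ 1 1 : ℝ) / (γ 1 0 : ℝ))| ≤ M * (p t).im
  finish : Filter.Tendsto (fun t => (p t).im) Filter.atTop Filter.atTop
  finish_cone : ∃ M : ℝ, ∀ᶠ t in Filter.atTop, |(p t).re| ≤ M * (p t).im

/-- The improper contour integral `∫ F(τ) dτ` along `p : (0, ∞) → ℂ` converges to `J`. -/
def HasContourIntegral (F : ℂ → ℂ) (p : ℝ → ℂ) (J : ℂ) : Prop :=
  Filter.Tendsto (fun x : ℝ × ℝ => ∫ t in x.1..x.2, F (p t) * deriv p t)
    (𝓝[>] 0 ×ˢ Filter.atTop) (𝓝 J)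

/-- The integrand `f(τ) (τ - z)^{k-2}`, for `τ` in the upper half-plane. -/
def periodIntegrand (k : ℝ) (f : UpperHalfPlane → ℂ) (γ : SL(2, ℤ)) (z τ : ℂ) : ℂ :=
  f (UpperHalfPlane.ofComplex τ) * branchPow (γ 1 0) (τ - z) ((k - 2 : ℝ) : ℂ)

end HalfIntegral

end

namespace HalfIntegral

open Filter Set MeasureTheory

/-! The Eichler integral is a period integral up to the vertical ray above `z`. Since `∫₀^∞ u^{k-2}
e^{-2πnu} du = Γ(k-1)(2πn)^{1-k}`, the series `f̃(z)` is a constant times `∫ f(τ)(τ-z)^{k-2} dτ`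
from `z` to `i∞` (`IsCuspForm.eichlerSeries_eq_integral`). The corresponding integral for `f̃(γz)`
starts at `γz`; pulled back by `γ` and the modularity of `f`, it becomes an integral from `z` to
`γ⁻¹(i∞) = -d/c`. Subtracting leaves the integral from `-d/c` to `i∞`.

With a half-integral exponent the difficulty lies in the branches. The comparison is therefore made
only for `z` on the vertical line over `-d/c`. There `γ` acts on vertical rays by a real
substitution, every power is a positive real power times an explicit exponential, and the phases can
be matched (`IsCuspForm.slash_eichlerIntegral_vertical`, `epsilonFactor_identity`). Such a `z` lies
on the natural path of integration, so the period integral is reached by moving `z` slightly off the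
line and using dominated convergence (`IsCuspForm.periodIntegral_vertical`). The identity theorem
carries the equality to the whole upper half-plane.

The integral itself makes sense on the full cut plane. The slit half-plane admits primitives, and
`f` decays rapidly in cones at both ends, so all admissible paths give one value
(`exists_hasContourIntegral`). Near each `z` this value can be computed along one fixed ray from
`-d/c`, and differentiation under the integral sign gives analyticity
(`IsCuspForm.differentiableAt_periodIntegral`). -/

/-! ### Primitives on the slit half-plane -/

/-- Two primitives on open sets with convex intersection can be glued. -/
theorem exists_primitive_union {g : ℂ → ℂ} {U V : Set ℂ} (hU : IsOpen U) (hV : IsOpen V)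
    (hUV : Convex ℝ (U ∩ V)) (h₁ : ∃ G : ℂ → ℂ, ∀ z ∈ U, HasDerivAt G (g z) z)
    (h₂ : ∃ G : ℂ → ℂ, ∀ z ∈ V, HasDerivAt G (g z) z) :
    ∃ G : ℂ → ℂ, ∀ z ∈ U ∪ V, HasDerivAt G (g z) z := by
  classical
  obtain ⟨G₁, hG₁⟩ := h₁
  obtain ⟨G₂, hG₂⟩ := h₂
  obtain ⟨c, hc⟩ : ∃ c : ℂ, ∀ z ∈ U ∩ V, G₁ z = G₂ z + c := by
    rcases (U ∩ V).eq_empty_or_nonempty with h | ⟨w, hw⟩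
    · exact ⟨0, by simp [h]⟩
    · refine ⟨G₁ w - G₂ w, fun z hz => ?_⟩
      have hd : ∀ x ∈ U ∩ V, HasDerivAt (fun x => G₁ x - G₂ x) 0 x := fun x hx => by
        rw [← sub_self (g x)]; exact (hG₁ x hx.1).sub (hG₂ x hx.2)
      have := (hU.inter hV).is_const_of_deriv_eq_zero hUV.isPreconnected
        (fun x hx => (hd x hx).differentiableAt.differentiableWithinAt)
        (fun x hx => (hd x hx).deriv) hz hw
      linear_combination this
  refine ⟨fun z => if z ∈ U then G₁ z else G₂ z + c, ?_⟩
  rintro z hz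
  by_cases hzU : z ∈ U
  · refine (hG₁ z hzU).congr_of_eventuallyEq ?_
    filter_upwards [hU.mem_nhds hzU] with x hx using if_pos hx
  · have hzV := hz.resolve_left hzU
    refine ((hG₂ z hzV).add_const c).congr_of_eventuallyEq ?_
    filter_upwards [hV.mem_nhds hzV] with x hx
    by_cases hxU : x ∈ U
    · simp only [hxU, if_true, hc x ⟨hxU, hx⟩]
    · simp only [hxU, if_false]

theorem exists_primitive_of_convex {g : ℂ → ℂ} {U : Set ℂ} (hU : IsOpen U) (hc : Convex ℝ U)
    (hg : DifferentiableOn ℂ g U) : ∃ G : ℂ → ℂ, ∀ z ∈ U, HasDerivAt G (g z) z := by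
  obtain ⟨G, hG⟩ := hc.exists_forall_hasDerivWithinAt hg
  exact ⟨G, fun z hz => (hG z hz).hasDerivAt (hU.mem_nhds hz)⟩

/-- The upper half-plane minus the branch cut. -/
def slitHalfPlane (c : ℤ) (z : ℂ) : Set ℂ := {τ | 0 < τ.im ∧ τ ∉ branchCut c z}

theorem mem_branchCut_iff {c : ℤ} (hc : c ≠ 0) {z τ : ℂ} :
    τ ∈ branchCut c z ↔ τ.im = z.im ∧ 0 ≤ (c.sign : ℝ) * (τ.re - z.re) := by
  constructor
  · rintro ⟨t, ht, rfl⟩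
    rcases lt_or_gt_of_ne hc with h | h
    · simp [Int.sign_eq_neg_one_of_neg h, ht]
    · simp [Int.sign_eq_one_of_pos h, ht]
  · rintro ⟨h1, h2⟩
    refine ⟨(c.sign : ℝ) * (τ.re - z.re), h2, ?_⟩
    rcases lt_or_gt_of_ne hc with h | h
    · apply Complex.ext <;> simp [Int.sign_eq_neg_one_of_neg h, h1]
    · apply Complex.ext <;> simp [Int.sign_eq_one_of_pos h, h1]

/-- A holomorphic function on the slit half-plane has a primitive. -/
theorem exists_primitive_slitHalfPlane {c : ℤ} (hc : c ≠ 0) {z : ℂ} {g : ℂ → ℂ}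
    (hg : DifferentiableOn ℂ g (slitHalfPlane c z)) :
    ∃ G : ℂ → ℂ, ∀ τ ∈ slitHalfPlane c z, HasDerivAt G (g τ) τ := by
  set s : ℝ := (c.sign : ℝ) with hs
  have hs0 : s ≠ 0 := by simpa [hs] using hc
  have him : ∀ a : ℝ, Convex ℝ {τ : ℂ | a < τ.im} ∧ IsOpen {τ : ℂ | a < τ.im} := fun a =>
    ⟨convex_halfSpace_im_gt a, isOpen_lt continuous_const Complex.continuous_im⟩
  have him' : ∀ a : ℝ, Convex ℝ {τ : ℂ | τ.im < a} ∧ IsOpen {τ : ℂ | τ.im < a} := fun a =>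
    ⟨convex_halfSpace_im_lt a, isOpen_lt Complex.continuous_im continuous_const⟩
  have hre : Convex ℝ {τ : ℂ | s * (τ.re - z.re) < 0} ∧ IsOpen {τ : ℂ | s * (τ.re - z.re) < 0} := by
    constructor
    · have h := convex_halfSpace_lt (𝕜 := ℝ) (f := fun τ : ℂ => s * τ.re)
        (IsLinearMap.mk (by intros; simp; ring) (by intros; simp; ring)) (s * z.re)
      simpa only [mul_sub, sub_neg] using h
    · exact isOpen_lt (by fun_prop) continuous_const
  -- Three convex pieces: above the cut, beside its end point, below it. Each meets the next in a
  -- convex set.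
  set U₁ := {τ : ℂ | 0 < τ.im} ∩ {τ : ℂ | z.im < τ.im}
  set U₂ := {τ : ℂ | 0 < τ.im} ∩ {τ : ℂ | s * (τ.re - z.re) < 0}
  set U₃ := {τ : ℂ | 0 < τ.im} ∩ {τ : ℂ | τ.im < z.im}
  have hU₁ : Convex ℝ U₁ ∧ IsOpen U₁ := ⟨(him 0).1.inter (him _).1, (him 0).2.inter (him _).2⟩
  have hU₂ : Convex ℝ U₂ ∧ IsOpen U₂ := ⟨(him 0).1.inter hre.1, (him 0).2.inter hre.2⟩
  have hU₃ : Convex ℝ U₃ ∧ IsOpen U₃ := ⟨(him 0).1.inter (him' _).1, (him 0).2.inter (him' _).2⟩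
  have hsub : slitHalfPlane c z = (U₁ ∪ U₂) ∪ U₃ := by
    ext τ
    simp only [slitHalfPlane, mem_ofPred_eq, mem_branchCut_iff hc, mem_union, mem_inter_iff, U₁, U₂,
      U₃, ← hs]
    constructor
    · rintro ⟨h1, h2⟩
      rcases lt_trichotomy τ.im z.im with h | h | h
      · exact Or.inr ⟨h1, h⟩
      · exact Or.inl (Or.inr ⟨h1, not_le.1 fun h' => h2 ⟨h, h'⟩⟩)
      · exact Or.inl (Or.inl ⟨h1, h⟩)
    · rintro ((h | h) | h)
      · exact ⟨h.1, fun h' => h.2.ne' h'.1⟩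
      · exact ⟨h.1, fun h' => h.2.not_ge h'.2⟩
      · exact ⟨h.1, fun h' => h.2.ne h'.1⟩
  rw [hsub] at hg ⊢
  refine exists_primitive_union (hU₁.2.union hU₂.2) hU₃.2 ?_
    (exists_primitive_union hU₁.2 hU₂.2 (hU₁.1.inter hU₂.1)
      (exists_primitive_of_convex hU₁.2 hU₁.1 (hg.mono fun x hx => Or.inl (Or.inl hx)))
      (exists_primitive_of_convex hU₂.2 hU₂.1 (hg.mono fun x hx => Or.inl (Or.inr hx))))
    (exists_primitive_of_convex hU₃.2 hU₃.1 (hg.mono fun x hx => Or.inr hx))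
  -- The pieces above and below the cut are disjoint, so only the overlap of `U₂` and `U₃` remains.
  convert hU₂.1.inter hU₃.1 using 1
  ext τ
  simp only [mem_union, mem_inter_iff, U₁, U₂, U₃, mem_ofPred_eq]
  constructor
  · rintro ⟨h | h, h'⟩
    · exact absurd h.2 h'.2.not_gt
    · exact ⟨h, h'⟩
  · rintro ⟨h, h'⟩; exact ⟨Or.inr h, h'⟩

/-! ### Limits at the cusps and independence of the path -/

/-- The bound on the integrand near an end point, `y → 0` or `y → ∞`, of the paths. -/
def ConeBound (U : Set ℂ) (g : ℂ → ℂ) (x₀ : ℝ) (l : Filter ℝ) : Prop :=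
  ∀ M : ℝ, ∃ C : ℝ, ∀ᶠ y in l, ∀ x : ℝ, |x - x₀| ≤ M * y →
    (⟨x, y⟩ : ℂ) ∈ U ∧ ‖g ⟨x, y⟩‖ ≤ C * (1 + y) ^ (-2 : ℝ)

theorem hasDerivAt_vertical {G : ℂ → ℂ} {g' : ℂ} {x₀ y : ℝ} (h : HasDerivAt G g' ⟨x₀, y⟩) :
    HasDerivAt (fun t : ℝ => G ⟨x₀, t⟩) (g' * Complex.I) y := by
  have h1 : HasDerivAt (fun t : ℝ => (⟨x₀, t⟩ : ℂ)) Complex.I y := by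
    have : HasDerivAt (fun t : ℝ => (x₀ : ℂ) + (t : ℂ) * Complex.I) Complex.I y := by
      simpa using ((Complex.ofRealCLM.hasDerivAt (x := y)).mul_const Complex.I).const_add (x₀ : ℂ)
    convert this using 2 with t
    exact Complex.mk_eq_add_mul_I _ _
  exact h.comp y h1

theorem exists_tendsto_vertical_atTop {U : Set ℂ} {g G : ℂ → ℂ} {x₀ : ℝ}
    (hg : ContinuousOn g U) (hG : ∀ τ ∈ U, HasDerivAt G (g τ) τ) (hb : ConeBound U g x₀ atTop) :
    ∃ L, Tendsto (fun y : ℝ => G ⟨x₀, y⟩) atTop (𝓝 L) := by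
  obtain ⟨C, hC⟩ := hb 0
  obtain ⟨A, hA⟩ := eventually_atTop.1 (hC.and (eventually_gt_atTop 0))
  have hA0 : 0 < A := (hA A le_rfl).2
  have hA' : ∀ y, A < y → (⟨x₀, y⟩ : ℂ) ∈ U ∧ ‖g ⟨x₀, y⟩‖ ≤ C * (1 + y) ^ (-2 : ℝ) :=
    fun y hy => (hA y hy.le).1 x₀ (by simp)
  refine ⟨_, MeasureTheory.tendsto_limUnder_of_hasDerivAt_of_integrableOn_Ioi (a := A)
    (fun y hy => hasDerivAt_vertical (hG _ (hA' y hy).1)) ?_⟩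
  have hcont : ContinuousOn (fun y : ℝ => g ⟨x₀, y⟩) (Ioi A) := by
    refine hg.comp (Continuous.continuousOn ?_) fun y hy => (hA' y hy).1
    have : Complex.mk x₀ = fun y : ℝ => x₀ + y * Complex.I :=
      funext fun y => Complex.mk_eq_add_mul_I _ _
    rw [this]; fun_prop
  refine MeasureTheory.Integrable.mono'
    (((integrableOn_add_rpow_Ioi_of_lt (a := -2) (c := A) (m := 1) (by norm_num)
      (by linarith)).const_mul C)) ((hcont.mul continuousOn_const).aestronglyMeasurable
        measurableSet_Ioi) ?_
  refine (MeasureTheory.ae_restrict_iff' measurableSet_Ioi).2 (MeasureTheory.ae_of_all _ fun y hy => ?_)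
  simpa [add_comm] using (hA' y hy).2

/-- A bounded derivative makes the primitive Lipschitz on the segment, and a Lipschitz function
extends continuously to its end point. -/
theorem exists_tendsto_vertical_zero {U : Set ℂ} {g G : ℂ → ℂ} {x₀ : ℝ}
    (hG : ∀ τ ∈ U, HasDerivAt G (g τ) τ) (hb : ConeBound U g x₀ (𝓝[>] 0)) :
    ∃ L, Tendsto (fun y : ℝ => G ⟨x₀, y⟩) (𝓝[>] 0) (𝓝 L) := by
  obtain ⟨C, hC⟩ := hb 0
  obtain ⟨A, hA0, hA⟩ := mem_nhdsGT_iff_exists_Ioo_subset.1 hC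
  have hA' : ∀ y ∈ Ioo 0 A, (⟨x₀, y⟩ : ℂ) ∈ U ∧ ‖g ⟨x₀, y⟩‖ ≤ C * (1 + y) ^ (-2 : ℝ) :=
    fun y hy => hA hy x₀ (by simp)
  have hlip : LipschitzOnWith (Real.toNNReal |C|) (fun y : ℝ => G ⟨x₀, y⟩) (Ioo 0 A) := by
    refine (convex_Ioo 0 A).lipschitzOnWith_of_nnnorm_hasDerivWithin_le
      (fun y hy => (hasDerivAt_vertical (hG _ (hA' y hy).1)).hasDerivWithinAt) fun y hy => ?_
    rw [← NNReal.coe_le_coe, Real.coe_toNNReal _ (abs_nonneg _), coe_nnnorm, norm_mul,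
      Complex.norm_I, mul_one]
    refine (hA' y hy).2.trans ?_
    have h1 : (1 + y) ^ (-2 : ℝ) ≤ 1 :=
      Real.rpow_le_one_of_one_le_of_nonpos (by linarith [hy.1]) (by norm_num)
    have h2 : 0 ≤ (1 + y) ^ (-2 : ℝ) := Real.rpow_nonneg (by linarith [hy.1]) _
    calc C * (1 + y) ^ (-2 : ℝ) ≤ |C| * 1 := by
          refine mul_le_mul (le_abs_self C) h1 h2 (abs_nonneg _)
      _ = |C| := mul_one _
  obtain ⟨φ, hφ, heq⟩ := hlip.extend_finite_dimension
  refine ⟨φ 0, ((hφ.continuous.tendsto 0).mono_left nhdsWithin_le_nhds).congr' ?_⟩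
  filter_upwards [Ioo_mem_nhdsGT hA0] with y hy using (heq hy).symm

/-- Inside a cone a primitive has the same limit as on the vertical line. -/
theorem tendsto_cone {U : Set ℂ} {g G : ℂ → ℂ} {x₀ : ℝ} {l : Filter ℝ}
    (hl : Tendsto (fun y : ℝ => y * (1 + y) ^ (-2 : ℝ)) l (𝓝 0)) (hl0 : ∀ᶠ y in l, 0 < y)
    (hG : ∀ τ ∈ U, HasDerivAt G (g τ) τ) (hb : ConeBound U g x₀ l) {L : ℂ}
    (hL : Tendsto (fun y : ℝ => G ⟨x₀, y⟩) l (𝓝 L)) {ι : Type*} {m : Filter ι} {p : ι → ℂ}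
    (hp : Tendsto (fun t => (p t).im) m l) {M : ℝ}
    (hM : ∀ᶠ t in m, |(p t).re - x₀| ≤ M * (p t).im) :
    Tendsto (fun t => G (p t)) m (𝓝 L) := by
  obtain ⟨C, hC⟩ := hb M
  have h1 : Tendsto (fun t => G (p t) - G ⟨x₀, (p t).im⟩) m (𝓝 0) := by
    have h2 : Tendsto (fun t => C * M * ((p t).im * (1 + (p t).im) ^ (-2 : ℝ))) m (𝓝 0) := by
      simpa using (hl.comp hp).const_mul (C * M)
    refine squeeze_zero_norm' ?_ h2
    filter_upwards [hp.eventually hC, hM, hp.eventually hl0] with t ht1 ht2 ht3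
    set y := (p t).im with hy
    set S : Set ℝ := {x : ℝ | |x - x₀| ≤ M * y}
    have hS : Convex ℝ S := by
      have : S = Metric.closedBall x₀ (M * y) := by
        ext x; simp [S, Real.dist_eq]
      rw [this]; exact convex_closedBall _ _
    have hd : ∀ x ∈ S, HasDerivWithinAt (fun x : ℝ => G ⟨x, y⟩) (g ⟨x, y⟩) S x := fun x hx => by
      have h3 : HasDerivAt (fun t : ℝ => (⟨t, y⟩ : ℂ)) 1 x := by
        have : HasDerivAt (fun t : ℝ => (t : ℂ) + (y : ℂ) * Complex.I) 1 x :=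
          (Complex.ofRealCLM.hasDerivAt (x := x)).add_const _
        convert this using 2 with t
        exact Complex.mk_eq_add_mul_I _ _
      have h5 := ((hG _ (ht1 x hx).1).comp x h3).hasDerivWithinAt (s := S)
      rwa [mul_one] at h5
    have hx₀ : x₀ ∈ S := by
      simp only [S, mem_ofPred_eq, sub_self, abs_zero]; exact (abs_nonneg _).trans ht2
    -- Mean value inequality on the horizontal segment at height `y`: its length is at most `M y`,
    -- so the difference is at most `C M y (1 + y)⁻²`, which vanishes at both ends.
    have h4 := hS.norm_image_sub_le_of_norm_hasDerivWithin_le hd (fun x hx => (ht1 x hx).2)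
      hx₀ (show (p t).re ∈ S from ht2)
    have hC0 : 0 ≤ C * (1 + y) ^ (-2 : ℝ) := (norm_nonneg _).trans (ht1 x₀ hx₀).2
    refine h4.trans ((mul_le_mul_of_nonneg_left ht2 hC0).trans (le_of_eq (by ring)))
  simpa using h1.add (hL.comp hp)

theorem tendsto_mul_rpow_neg_two_zero :
    Tendsto (fun y : ℝ => y * (1 + y) ^ (-2 : ℝ)) (𝓝[>] 0) (𝓝 0) := by
  have : ContinuousAt (fun y : ℝ => y * (1 + y) ^ (-2 : ℝ)) 0 :=
    continuousAt_id.mul ((continuousAt_const.add continuousAt_id).rpow_const (by simp))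
  simpa using this.tendsto.mono_left nhdsWithin_le_nhds

theorem tendsto_mul_rpow_neg_two_atTop :
    Tendsto (fun y : ℝ => y * (1 + y) ^ (-2 : ℝ)) atTop (𝓝 0) := by
  have h : Tendsto (fun y : ℝ => (1 + y) ^ (-1 : ℝ)) atTop (𝓝 0) :=
    (tendsto_rpow_neg_atTop one_pos).comp (tendsto_atTop_add_const_left _ _ tendsto_id)
  refine squeeze_zero' ?_ ?_ h
  · filter_upwards [eventually_gt_atTop 0] with y hy using by positivity
  · filter_upwards [eventually_gt_atTop 0] with y hy
    have h1 : (1 + y) ^ (-1 : ℝ) = (1 + y) * (1 + y) ^ (-2 : ℝ) := by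
      rw [← Real.rpow_one_add' (by linarith) (by norm_num)]; norm_num
    rw [h1]
    gcongr
    linarith

/-- The contour integral converges to the same value along all admissible paths. -/
theorem exists_hasContourIntegral {γ : SL(2, ℤ)} (hc : γ 1 0 ≠ 0) {z : ℂ} {g : ℂ → ℂ}
    (hg : DifferentiableOn ℂ g (slitHalfPlane (γ 1 0) z))
    (hb₀ : ConeBound (slitHalfPlane (γ 1 0) z) g (-(γ 1 1 : ℝ) / (γ 1 0 : ℝ)) (𝓝[>] 0))
    (hb₁ : ConeBound (slitHalfPlane (γ 1 0) z) g (-(γ 1 1 : ℝ) / (γ 1 0 : ℝ)) atTop) :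
    ∃ J : ℂ, ∀ p : ℝ → ℂ, IsAdmissiblePath γ z p → HasContourIntegral g p J := by
  obtain ⟨G, hG⟩ := exists_primitive_slitHalfPlane hc hg
  obtain ⟨L₀, hL₀⟩ := exists_tendsto_vertical_zero hG hb₀
  obtain ⟨L₁, hL₁⟩ := exists_tendsto_vertical_atTop hg.continuousOn hG hb₁
  refine ⟨L₁ - L₀, fun p hp => ?_⟩
  set x₀ : ℝ := -(γ 1 1 : ℝ) / (γ 1 0 : ℝ) with hx₀
  have hmem : ∀ t, 0 < t → p t ∈ slitHalfPlane (γ 1 0) z := fun t ht =>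
    ⟨hp.im_pos t ht, hp.avoids t ht⟩
  have h0 : Tendsto (fun t => G (p t)) (𝓝[>] 0) (𝓝 L₀) := by
    obtain ⟨M, hM⟩ := hp.start_cone
    refine tendsto_cone tendsto_mul_rpow_neg_two_zero self_mem_nhdsWithin hG hb₀ hL₀ ?_ hM
    refine tendsto_nhdsWithin_iff.2 ⟨?_, ?_⟩
    · have h := (Complex.continuous_im.tendsto _).comp hp.start
      have h2 : (-(γ 1 1 : ℂ) / (γ 1 0 : ℂ)) = (x₀ : ℂ) := by simp [hx₀]
      rw [h2, Complex.ofReal_im] at h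
      exact h
    · filter_upwards [self_mem_nhdsWithin] with t ht using hp.im_pos t ht
  have h1 : Tendsto (fun t => G (p t)) atTop (𝓝 L₁) := by
    -- The cone at `i∞` is centred at `0`; recentring it at `x₀` costs `|x₀|` in the slope once the
    -- height is at least `1`.
    obtain ⟨M, hM⟩ := hp.finish_cone
    refine tendsto_cone (M := M + |x₀|) tendsto_mul_rpow_neg_two_atTop (eventually_gt_atTop 0) hG
      hb₁ hL₁ hp.finish ?_
    filter_upwards [hM, hp.finish.eventually_ge_atTop 1] with t ht1 ht2
    calc |(p t).re - x₀| ≤ |(p t).re| + |x₀| := abs_sub _ _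
      _ ≤ M * (p t).im + |x₀| * (p t).im :=
        add_le_add ht1 (le_mul_of_one_le_right (abs_nonneg _) ht2)
      _ = _ := by ring
  have h2 : Tendsto (fun x : ℝ × ℝ => G (p x.2) - G (p x.1)) (𝓝[>] 0 ×ˢ atTop) (𝓝 (L₁ - L₀)) :=
    (h1.comp tendsto_snd).sub (h0.comp tendsto_fst)
  refine h2.congr' ?_
  have h3 : ∀ᶠ x : ℝ × ℝ in 𝓝[>] 0 ×ˢ atTop, 0 < x.1 ∧ 0 < x.2 :=
    (eventually_mem_nhdsWithin (s := Ioi (0 : ℝ))).prod_mk (eventually_gt_atTop 0)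
  filter_upwards [h3] with x hx
  have hsub : uIcc x.1 x.2 ⊆ Ioi 0 := fun t ht =>
    lt_of_lt_of_le (lt_min hx.1 hx.2) ht.1
  obtain ⟨S, hS, hd⟩ := hp.diff
  symm
  refine MeasureTheory.integral_eq_of_hasDerivAt_off_countable (fun t => G (p t)) _ hS ?_ ?_ ?_
  · exact fun t ht => (hG _ (hmem t (hsub ht))).continuousAt.comp_continuousWithinAt
      ((hp.cont t (hsub ht)).mono hsub)
  · intro t ht
    have ht0 : 0 < t := (lt_min hx.1 hx.2).trans ht.1.1
    exact (hG _ (hmem t ht0)).comp t (hd t ht0 ht.2).hasDerivAt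
  · have h4 : IntervalIntegrable (deriv p) MeasureTheory.volume x.1 x.2 :=
      (intervalIntegrable_iff' (by simp)).2
        (hp.deriv_int.integrableOn_compact_subset hsub isCompact_uIcc)
    refine h4.continuousOn_mul ?_
    exact hg.continuousOn.comp (hp.cont.mono hsub) fun t ht => hmem t (hsub ht)

/-! ### The branch of the power -/

theorem notMem_branchCut_iff {c : ℤ} (hc : c ≠ 0) {z τ : ℂ} :
    τ ∉ branchCut c z ↔ -(c.sign : ℂ) * (τ - z) ∈ Complex.slitPlane := by
  rw [mem_branchCut_iff hc, Complex.mem_slitPlane_iff]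
  have hs : ((c.sign : ℝ) : ℂ) = (c.sign : ℂ) := by simp
  have hs0 : (c.sign : ℝ) ≠ 0 := by simpa using hc
  rw [← hs, ← Complex.ofReal_neg, Complex.re_ofReal_mul, Complex.im_ofReal_mul, Complex.sub_re,
    Complex.sub_im, not_and, not_le, neg_mul, neg_mul]
  constructor
  · intro h
    by_cases h1 : τ.im = z.im
    · exact Or.inl (by linarith [h h1])
    · exact Or.inr (neg_ne_zero.2 (mul_ne_zero hs0 (sub_ne_zero.2 h1)))
  · rintro (h | h) h1
    · linarith
    · simp [h1] at h

theorem hasDerivAt_branchPow {c : ℤ} (hc : c ≠ 0) {w : ℂ} (s : ℂ)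
    (hw : -(c.sign : ℂ) * w ∈ Complex.slitPlane) :
    HasDerivAt (fun w => branchPow c w s) (s * branchPow c w (s - 1)) w := by
  unfold branchPow
  rcases lt_or_gt_of_ne hc with h | h
  · simp only [h.not_gt, if_false]
    rw [Int.sign_eq_neg_one_of_neg h] at hw
    simpa using (hasDerivAt_id w).cpow_const (c := s) (by simpa using hw)
  · simp only [h, if_true]
    rw [Int.sign_eq_one_of_pos h] at hw
    have h1 := (((hasDerivAt_id w).neg).cpow_const (c := s) (by simpa using hw)).const_mul
      (Complex.exp (Real.pi * Complex.I * s))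
    -- Lowering the exponent by one changes the sign of the prefactor, which cancels the sign from
    -- differentiating `-w`.
    have h2 : Complex.exp (Real.pi * Complex.I * s) =
        -Complex.exp (Real.pi * Complex.I * (s - 1)) := by
      rw [mul_sub, mul_one, Complex.exp_sub, Complex.exp_pi_mul_I]; ring
    refine h1.congr_deriv ?_
    simp only [Pi.neg_apply, id]
    rw [h2]; ring

theorem norm_branchPow (c : ℤ) (w : ℂ) (s : ℝ) : ‖branchPow c w (s : ℂ)‖ = ‖w‖ ^ s := by
  unfold branchPow
  split_ifs
  · have : Real.pi * Complex.I * (s : ℂ) = ((Real.pi * s : ℝ) : ℂ) * Complex.I := by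
      push_cast; ring
    rw [norm_mul, this, Complex.norm_exp_ofReal_mul_I, Complex.norm_cpow_real, norm_neg, one_mul]
  · exact Complex.norm_cpow_real _ _

theorem ofReal_mul_cpow {u : ℝ} (hu : 0 < u) {w : ℂ} (hw : w ≠ 0) (s : ℂ) :
    ((u : ℂ) * w) ^ s = (u : ℂ) ^ s * w ^ s := by
  have hu' : (u : ℂ) ≠ 0 := by exact_mod_cast hu.ne'
  rw [Complex.cpow_def_of_ne_zero (mul_ne_zero hu' hw), Complex.cpow_def_of_ne_zero hu',
    Complex.cpow_def_of_ne_zero hw, Complex.log_ofReal_mul hu hw, ← Complex.exp_add,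
    Complex.ofReal_log hu.le, add_mul]

theorem I_cpow (s : ℂ) : Complex.I ^ s = Complex.exp (Real.pi * Complex.I * s / 2) := by
  rw [Complex.cpow_def_of_ne_zero Complex.I_ne_zero, Complex.log_I]; ring_nf

theorem neg_I_cpow (s : ℂ) : (-Complex.I) ^ s = Complex.exp (-(Real.pi * Complex.I * s / 2)) := by
  rw [Complex.cpow_def_of_ne_zero (neg_ne_zero.2 Complex.I_ne_zero), Complex.log_neg_I]; ring_nf

theorem branchPow_mul_I {u : ℝ} (hu : 0 < u) (c : ℤ) (s : ℂ) :
    branchPow c (u * Complex.I) s = (u : ℂ) ^ s * Complex.exp (Real.pi * Complex.I * s / 2) := by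
  unfold branchPow
  split_ifs
  · rw [← mul_neg, ofReal_mul_cpow hu (neg_ne_zero.2 Complex.I_ne_zero), neg_I_cpow, mul_left_comm,
      ← Complex.exp_add]
    ring_nf
  · rw [ofReal_mul_cpow hu Complex.I_ne_zero, I_cpow]

/-- On the negative imaginary axis the chosen argument is `3π/2` for `c > 0` and `-π/2` for `c < 0`,
that is, `sign(c)π + π/2`. -/
theorem branchPow_neg_mul_I {u : ℝ} (hu : 0 < u) {c : ℤ} (hc : c ≠ 0) (s : ℂ) :
    branchPow c (-(u * Complex.I)) s = (u : ℂ) ^ s *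
      Complex.exp (c.sign * (Real.pi * Complex.I * s) + Real.pi * Complex.I * s / 2) := by
  unfold branchPow
  rcases lt_or_gt_of_ne hc with h | h
  · rw [if_neg h.not_gt, ← mul_neg, ofReal_mul_cpow hu (neg_ne_zero.2 Complex.I_ne_zero),
      neg_I_cpow, Int.sign_eq_neg_one_of_neg h]
    congr 2
    push_cast; ring
  · rw [if_pos h, neg_neg, ofReal_mul_cpow hu Complex.I_ne_zero, I_cpow, mul_left_comm,
      ← Complex.exp_add, Int.sign_eq_one_of_pos h]
    congr 2
    push_cast; ring

/-! ### The Kronecker symbol, the slash factors and the cusp -/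

theorem padicValNat_two_natAbs_of_odd {d : ℤ} (hd : d % 2 = 1) : padicValNat 2 d.natAbs = 0 :=
  padicValNat.eq_zero_of_not_dvd (by omega)

theorem kronecker_sq {c d : ℤ} (hd : d % 2 = 1) (hcd : IsCoprime c d) : kronecker c d ^ 2 = 1 := by
  have h0 : d ≠ 0 := by rintro rfl; simp at hd
  have h1 : jacobiSym c d.natAbs ^ 2 = 1 := by
    apply jacobiSym.sq_one
    have := Int.isCoprime_iff_gcd_eq_one.1 hcd
    simpa only [Int.gcd, Int.natAbs_natCast] using this
  unfold kronecker
  rw [if_neg h0, padicValNat_two_natAbs_of_odd hd]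
  simp only [pow_zero, mul_one, Nat.div_one, mul_pow, h1]
  split_ifs <;> simp

theorem kronecker_neg_four {d : ℤ} (hd : d % 2 = 1) :
    kronecker (-4) d = if d % 4 = 1 then 1 else -1 := by
  have h0 : d ≠ 0 := by rintro rfl; simp at hd
  have hodd : Odd d.natAbs := by rw [Nat.odd_iff]; omega
  have h1 : jacobiSym (-4) d.natAbs = ZMod.χ₄ (d.natAbs : ZMod 4) := by
    have h4 : (-4 : ℤ) = -1 * 2 ^ 2 := by norm_num
    rw [h4, jacobiSym.mul_left, jacobiSym.pow_left, jacobiSym.at_neg_one hodd,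
      jacobiSym.sq_one, mul_one]
    simp only [Int.gcd, Int.natAbs_natCast]
    exact (Nat.coprime_two_left).2 hodd
  unfold kronecker
  rw [if_neg h0, padicValNat_two_natAbs_of_odd hd]
  simp only [pow_zero, mul_one, Nat.div_one, h1, ZMod.χ₄_nat_eq_if_mod_four]
  split_ifs <;> omega

theorem norm_epsilonFactor (d : ℤ) : ‖epsilonFactor d‖ = 1 := by
  unfold epsilonFactor; split_ifs <;> simp

section

variable {N : ℕ} {γ : SL(2, ℤ)}

theorem det_eq_one (γ : SL(2, ℤ)) : γ 0 0 * γ 1 1 - γ 0 1 * γ 1 0 = 1 := by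
  rw [← Matrix.det_fin_two]; exact γ.det_coe

theorem isCoprime_row (γ : SL(2, ℤ)) : IsCoprime (γ 1 0) (γ 1 1) :=
  ⟨-γ 0 1, γ 0 0, by linarith [det_eq_one γ]⟩

theorem odd_of_mem_Gamma0 (h4 : 4 ∣ N) (hγ : γ ∈ CongruenceSubgroup.Gamma0 N) :
    γ 1 1 % 2 = 1 := by
  have h1 : (N : ℤ) ∣ γ 1 0 := (ZMod.intCast_zmod_eq_zero_iff_dvd _ _).1
    (CongruenceSubgroup.Gamma0_mem.1 hγ)
  have h2 : (2 : ℤ) ∣ γ 1 0 := (by norm_num : (2 : ℤ) ∣ 4).trans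
    ((by exact_mod_cast h4 : (4 : ℤ) ∣ N).trans h1)
  obtain ⟨e, he⟩ := h2
  have h3 := det_eq_one γ
  rw [he] at h3
  rcases Int.emod_two_eq_zero_or_one (γ 1 1) with h | h
  · obtain ⟨r, hr⟩ := Int.dvd_of_emod_eq_zero h
    rw [hr] at h3
    have : 2 * (γ 0 0 * r - γ 0 1 * e) = 1 := by linarith
    omega
  · exact h

theorem coe_smul_eq (γ : SL(2, ℤ)) (z : UpperHalfPlane) :
    ((γ • z : UpperHalfPlane) : ℂ) = ((γ 0 0 : ℂ) * z + γ 0 1) / autFactor γ z := by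
  rw [UpperHalfPlane.coe_specialLinearGroup_apply]; simp [autFactor]

theorem im_smul_eq (γ : SL(2, ℤ)) (z : UpperHalfPlane) :
    (γ • z).im = z.im / ‖autFactor γ z‖ ^ 2 := by
  rw [ModularGroup.im_smul_eq_div_normSq, Complex.normSq_eq_norm_sq]
  simp [autFactor, UpperHalfPlane.denom]

/-- Since `d` is odd and prime to `c`, the symbol `(c/d)` is `±1`, so only the automorphy factor
affects the size. -/
theorem norm_slash (h4 : 4 ∣ N) (hγ : γ ∈ CongruenceSubgroup.Gamma0 N) (κ : ℝ)
    (f : UpperHalfPlane → ℂ) (z : UpperHalfPlane) :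
    ‖slash κ γ f z‖ = ‖autFactor γ z‖ ^ (-κ) * ‖f (γ • z)‖ := by
  have h1 : ‖(kronecker (γ 1 0) (γ 1 1) : ℂ)‖ = 1 := by
    have h := kronecker_sq (odd_of_mem_Gamma0 h4 hγ) (isCoprime_row γ)
    rcases mul_self_eq_one_iff.1 ((sq _).symm.trans h) with h | h <;> simp [h]
  rw [slash, norm_mul, norm_mul, norm_mul, h1, Complex.norm_cpow_real, Complex.norm_cpow_real,
    norm_epsilonFactor]
  simp

/-- The point `γ⁻¹(i∞) = -d/c`. -/
noncomputable def cuspPoint (γ : SL(2, ℤ)) : ℝ := -(γ 1 1 : ℝ) / (γ 1 0 : ℝ)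

theorem autFactor_eq (hc : γ 1 0 ≠ 0) (z : ℂ) :
    autFactor γ z = (γ 1 0 : ℂ) * (z - cuspPoint γ) := by
  have : (γ 1 0 : ℂ) ≠ 0 := by exact_mod_cast hc
  simp only [autFactor, cuspPoint]
  push_cast
  field_simp
  ring

theorem mem_cutPlane_iff (hc : γ 1 0 ≠ 0) {z : ℂ} :
    z ∈ cutPlane γ ↔ z.im ≠ 0 ∨ 0 < ((γ 1 0).sign : ℝ) * (z.re - cuspPoint γ) := by
  have h2 : ((γ 1 0 : ℤ) : ℂ) = ((γ 1 0 : ℝ) : ℂ) := by simp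
  change autFactor γ z ∈ Complex.slitPlane ↔ _
  rw [autFactor_eq hc, Complex.mem_slitPlane_iff, h2, Complex.re_ofReal_mul, Complex.im_ofReal_mul]
  simp only [Complex.sub_re, Complex.sub_im, Complex.ofReal_re, Complex.ofReal_im, sub_zero]
  have hc' : (γ 1 0 : ℝ) ≠ 0 := by exact_mod_cast hc
  have h3 : γ 1 0 * z.im ≠ 0 ↔ z.im ≠ 0 := by simp [hc]
  rw [or_comm, h3]
  refine or_congr_right ?_
  rcases lt_or_gt_of_ne hc with h | h
  · have : (γ 1 0 : ℝ) < 0 := by exact_mod_cast h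
    rw [Int.sign_eq_neg_one_of_neg h]
    push_cast
    constructor <;> intro h' <;> nlinarith
  · have : (0 : ℝ) < (γ 1 0 : ℝ) := by exact_mod_cast h
    rw [Int.sign_eq_one_of_pos h, mul_pos_iff_of_pos_left this]
    simp

end

/-! ### Growth of the cusp form and of the integrand in cones -/

variable {N : ℕ} {k : ℝ} {f : UpperHalfPlane → ℂ} {γ : SL(2, ℤ)}

theorem autFactor_ne_zero (γ : SL(2, ℤ)) (z : UpperHalfPlane) : autFactor γ z ≠ 0 := by
  intro h
  -- If `cz + d` were `0`, division by zero would make the right side `0`, against `Im γz > 0`.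
  have := im_smul_eq γ z
  rw [h] at this
  simp at this
  exact (γ • z).im_pos.ne' this

theorem IsCuspForm.differentiableOn (hf : IsCuspForm N k f) :
    DifferentiableOn ℂ (fun τ => f (UpperHalfPlane.ofComplex τ)) {τ | 0 < τ.im} :=
  UpperHalfPlane.mdifferentiable_iff.1 hf.holo

theorem autFactor_one (z : ℂ) : autFactor 1 z = 1 := by simp [autFactor]

theorem IsCuspForm.isBigO_exp (hf : IsCuspForm N k f) : ∃ δ : ℝ, 0 < δ ∧
    f =O[UpperHalfPlane.atImInfty] fun z => Real.exp (-δ * z.im) := by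
  obtain ⟨δ, hδ, h⟩ := hf.decay 1
  exact ⟨δ, hδ, by simpa [autFactor_one] using h⟩

theorem IsCuspForm.exists_norm_le_exp (hf : IsCuspForm N k f) : ∃ δ C A : ℝ, 0 < δ ∧ 0 < C ∧
    ∀ z : UpperHalfPlane, A ≤ z.im → ‖f z‖ ≤ C * Real.exp (-δ * z.im) := by
  obtain ⟨δ, hδ, h⟩ := hf.isBigO_exp
  obtain ⟨C, hC, h⟩ := h.exists_pos
  obtain ⟨A, hA⟩ := (UpperHalfPlane.atImInfty_mem _).1 h.bound
  exact ⟨δ, C, A, hδ, hC, fun z hz => by simpa using hA z hz⟩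

theorem eventually_rpow_mul_exp_le_one (A : ℝ) {δ : ℝ} (hδ : 0 < δ) :
    ∀ᶠ y : ℝ in atTop, Real.exp (-δ * y) ≤ (1 + y) ^ (-A) := by
  have h1 := ((tendsto_rpow_mul_exp_neg_mul_atTop_nhds_zero A δ hδ).comp
    (tendsto_atTop_add_const_left atTop (1 : ℝ) tendsto_id)).mul_const (Real.exp δ)
  rw [zero_mul] at h1
  filter_upwards [h1.eventually_le_const one_pos, eventually_gt_atTop 0] with y hy hy0
  simp only [Function.comp, id] at hy
  have h2 : Real.exp (-δ * (1 + y)) * Real.exp δ = Real.exp (-δ * y) := by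
    rw [← Real.exp_add]; ring_nf
  rw [mul_assoc, h2] at hy
  rw [Real.rpow_neg (by linarith), ← one_div, le_div_iff₀' (by positivity)]
  exact hy

theorem ofComplex_mk {x y : ℝ} (hy : 0 < y) :
    UpperHalfPlane.ofComplex ⟨x, y⟩ = (⟨⟨x, y⟩, hy⟩ : UpperHalfPlane) :=
  UpperHalfPlane.ofComplex_apply_of_im_pos hy

theorem IsCuspForm.cone_bound_atTop (hf : IsCuspForm N k f) (A : ℝ) :
    ∃ C : ℝ, ∀ᶠ y : ℝ in atTop, ∀ x : ℝ,
      ‖f (UpperHalfPlane.ofComplex ⟨x, y⟩)‖ ≤ C * (1 + y) ^ (-A) := by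
  obtain ⟨δ, C, B, hδ, hC, h⟩ := hf.exists_norm_le_exp
  refine ⟨C, ?_⟩
  filter_upwards [eventually_rpow_mul_exp_le_one A hδ, eventually_gt_atTop 0, eventually_ge_atTop B]
    with y hy hy0 hyB x
  rw [ofComplex_mk hy0]
  exact (h ⟨⟨x, y⟩, hy0⟩ hyB).trans (mul_le_mul_of_nonneg_left hy hC.le)

theorem norm_sub_le_of_cone {x x₀ y M : ℝ} (hy : 0 < y) (hx : |x - x₀| ≤ M * y) :
    y ≤ ‖(⟨x, y⟩ : ℂ) - x₀‖ ∧ ‖(⟨x, y⟩ : ℂ) - x₀‖ ≤ (M + 1) * y := by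
  constructor
  · have := Complex.abs_im_le_norm ((⟨x, y⟩ : ℂ) - x₀)
    simpa [abs_of_pos hy] using this
  · refine (Complex.norm_le_abs_re_add_abs_im _).trans ?_
    simp [abs_of_pos hy]; linarith

/-- The cusp `-d/c` is sent to `i∞` by `γ`. In the cone `|cz + d|` is comparable to `y`, so `Im γz`
is at least a multiple of `1/y`; the exponential decay of `f(γz)` beats the factor `|cz + d|^{-k}`.
-/
theorem IsCuspForm.cone_bound_zero (hf : IsCuspForm N k f) (h4 : 4 ∣ N) (hk : 0 < k)
    (hγ : γ ∈ CongruenceSubgroup.Gamma0 N) (hc : γ 1 0 ≠ 0) (M A : ℝ) (hA : 0 ≤ A) :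
    ∃ C : ℝ, ∀ᶠ y : ℝ in 𝓝[>] 0, ∀ x : ℝ, |x - cuspPoint γ| ≤ M * y →
      ‖f (UpperHalfPlane.ofComplex ⟨x, y⟩)‖ ≤ C * (1 + y) ^ (-A) := by
  obtain ⟨δ, C, B, hδ, hC, h⟩ := hf.exists_norm_le_exp
  set c : ℝ := |(γ 1 0 : ℝ)| with hcdef
  have hc0 : 0 < c := abs_pos.2 (by exact_mod_cast hc)
  set K : ℝ := (c * (|M| + 1)) ^ 2 with hK
  have hK0 : 0 < K := by positivity
  have hinv : Tendsto (fun y : ℝ => y⁻¹) (𝓝[>] 0) atTop := tendsto_inv_nhdsGT_zero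
  have h1 := hinv.eventually
    ((tendsto_rpow_mul_exp_neg_mul_atTop_nhds_zero k (δ / K) (by positivity)).eventually_le_const
      one_pos)
  -- The factor `2 ^ A` compensates `(1 + y)^(-A)` for `y < 1`.
  refine ⟨C * c ^ (-k) * 2 ^ A, ?_⟩
  filter_upwards [h1, hinv.eventually_ge_atTop (B * K), self_mem_nhdsWithin,
    Ioo_mem_nhdsGT one_pos] with y hy1 hy2 hy0 hy3 x hx
  rw [mem_Ioi] at hy0
  set z : UpperHalfPlane := ⟨⟨x, y⟩, hy0⟩ with hz
  have hx' : |x - cuspPoint γ| ≤ |M| * y :=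
    hx.trans (mul_le_mul_of_nonneg_right (le_abs_self M) hy0.le)
  obtain ⟨hl, hu⟩ := norm_sub_le_of_cone hy0 hx'
  have hn : ‖autFactor γ z‖ = c * ‖(⟨x, y⟩ : ℂ) - cuspPoint γ‖ := by
    rw [autFactor_eq hc, norm_mul, Complex.norm_intCast]
  have hn1 : c * y ≤ ‖autFactor γ z‖ := by rw [hn]; gcongr
  have hn2 : ‖autFactor γ z‖ ^ 2 ≤ K * y ^ 2 := by
    rw [hn, hK, ← mul_pow]
    have : c * ‖(⟨x, y⟩ : ℂ) - cuspPoint γ‖ ≤ c * (|M| + 1) * y := by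
      rw [mul_assoc]; gcongr
    gcongr
  have hn0 : 0 < ‖autFactor γ z‖ := (mul_pos hc0 hy0).trans_le hn1
  have him : y⁻¹ / K ≤ (γ • z).im := by
    rw [im_smul_eq]
    change _ ≤ y / _
    rw [le_div_iff₀ (by positivity)]
    calc y⁻¹ / K * ‖autFactor γ z‖ ^ 2 ≤ y⁻¹ / K * (K * y ^ 2) := by gcongr
      _ = y := by field_simp
  have hB : B ≤ (γ • z).im := le_trans ((le_div_iff₀ hK0).2 hy2) him
  rw [ofComplex_mk hy0, hf.slash_eq γ hγ, norm_slash h4 hγ]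
  have e1 : ‖autFactor γ z‖ ^ (-k) ≤ c ^ (-k) * (y⁻¹) ^ k := by
    rw [Real.inv_rpow hy0.le, ← Real.rpow_neg hy0.le, ← Real.mul_rpow hc0.le hy0.le]
    exact Real.rpow_le_rpow_of_nonpos (by positivity) hn1 (by linarith)
  have e2 : ‖f (γ • z)‖ ≤ C * Real.exp (-(δ / K) * y⁻¹) := by
    refine (h _ hB).trans (mul_le_mul_of_nonneg_left (Real.exp_le_exp.2 ?_) hC.le)
    have := mul_le_mul_of_nonneg_left him hδ.le
    calc -δ * (γ • z).im ≤ -(δ * (y⁻¹ / K)) := by linarith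
      _ = -(δ / K) * y⁻¹ := by ring
  have e3 : 1 ≤ 2 ^ A * (1 + y) ^ (-A) := by
    rw [Real.rpow_neg (by linarith), ← div_eq_mul_inv, one_le_div (by positivity)]
    exact Real.rpow_le_rpow (by linarith) (by linarith [hy3.2]) hA
  calc ‖autFactor γ z‖ ^ (-k) * ‖f (γ • z)‖
      ≤ (c ^ (-k) * (y⁻¹) ^ k) * (C * Real.exp (-(δ / K) * y⁻¹)) := by gcongr
    _ = C * c ^ (-k) * ((y⁻¹) ^ k * Real.exp (-(δ / K) * y⁻¹)) := by ring
    _ ≤ C * c ^ (-k) * 1 := by gcongr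
    _ ≤ C * c ^ (-k) * (2 ^ A * (1 + y) ^ (-A)) := by gcongr
    _ = _ := by ring

/-- In a cone at the cusp `-d/c`, `f` is bounded and decays faster than any power of the height. -/
theorem IsCuspForm.cone_bound (hf : IsCuspForm N k f) (h4 : 4 ∣ N) (hk : 0 < k)
    (hγ : γ ∈ CongruenceSubgroup.Gamma0 N) (hc : γ 1 0 ≠ 0) (M A : ℝ) (hA : 0 ≤ A) :
    ∃ C : ℝ, 0 ≤ C ∧ ∀ y : ℝ, 0 < y → ∀ x : ℝ, |x - cuspPoint γ| ≤ M * y →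
      ‖f (UpperHalfPlane.ofComplex ⟨x, y⟩)‖ ≤ C * (1 + y) ^ (-A) := by
  obtain ⟨C₁, h₁⟩ := hf.cone_bound_zero h4 hk hγ hc M A hA
  obtain ⟨C₂, h₂⟩ := hf.cone_bound_atTop A
  obtain ⟨a, ha0, ha⟩ := mem_nhdsGT_iff_exists_Ioo_subset.1 h₁
  obtain ⟨b, hb⟩ := eventually_atTop.1 h₂
  rw [mem_Ioi] at ha0
  -- This compact rectangle contains the part of the cone at heights between `a` and `b`, not
  -- covered by the two asymptotic bounds.
  set S : Set (ℝ × ℝ) := Icc (cuspPoint γ - |M| * b) (cuspPoint γ + |M| * b) ×ˢ Icc a b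
  have hS : IsCompact S := isCompact_Icc.prod isCompact_Icc
  have hcont : ContinuousOn (fun q : ℝ × ℝ => f (UpperHalfPlane.ofComplex ⟨q.1, q.2⟩)) S := by
    refine hf.differentiableOn.continuousOn.comp (f := fun q : ℝ × ℝ => (⟨q.1, q.2⟩ : ℂ)) ?_ ?_
    · simp_rw [Complex.mk_eq_add_mul_I]
      fun_prop
    · rintro ⟨x, y⟩ hq
      exact ha0.trans_le hq.2.1
  obtain ⟨C₃, h₃⟩ := hS.exists_bound_of_continuousOn hcont
  refine ⟨|C₁| + |C₂| + |C₃| * (1 + |b|) ^ A, by positivity, fun y hy x hx => ?_⟩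
  have hy1 : 0 < (1 + y) ^ (-A) := by positivity
  have hp : 0 ≤ |C₃| * (1 + |b|) ^ A := by positivity
  by_cases hya : y < a
  · refine (ha ⟨hy, hya⟩ x hx).trans ?_
    gcongr
    linarith [le_abs_self C₁, abs_nonneg C₂]
  by_cases hyb : b ≤ y
  · refine (hb y hyb x).trans ?_
    gcongr
    linarith [le_abs_self C₂, abs_nonneg C₁]
  push Not at hya hyb
  have hmem : (x, y) ∈ S := by
    have h1 : |x - cuspPoint γ| ≤ |M| * b := hx.trans
      (mul_le_mul (le_abs_self M) hyb.le hy.le (abs_nonneg M))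
    rw [abs_le] at h1
    exact ⟨⟨by linarith, by linarith⟩, hya, hyb.le⟩
  have e : 1 ≤ (1 + |b|) ^ A * (1 + y) ^ (-A) := by
    rw [Real.rpow_neg (by linarith), ← div_eq_mul_inv, one_le_div (by positivity)]
    exact Real.rpow_le_rpow (by linarith) (by linarith [le_abs_self b]) hA
  calc ‖f (UpperHalfPlane.ofComplex ⟨x, y⟩)‖ ≤ |C₃| := (h₃ _ hmem).trans (le_abs_self _)
    _ ≤ |C₃| * ((1 + |b|) ^ A * (1 + y) ^ (-A)) := le_mul_of_one_le_right (abs_nonneg _) e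
    _ = |C₃| * (1 + |b|) ^ A * (1 + y) ^ (-A) := by ring
    _ ≤ _ := by gcongr; linarith [abs_nonneg C₁, abs_nonneg C₂]

/-- A negative exponent uses the lower bound on `w`, a nonnegative one the upper bound; adding the
constants treats both signs at once. -/
theorem rpow_le_mul_one_add_rpow {r K w y : ℝ} (e : ℝ) (hr : 0 < r) (hK : 0 < K) (hy : 0 ≤ y)
    (h1 : r ≤ w) (h2 : w ≤ K * (1 + y)) : w ^ e ≤ (r ^ e + K ^ e) * (1 + y) ^ |e| := by
  have hre : 0 < r ^ e := Real.rpow_pos_of_pos hr _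
  have hKe : 0 < K ^ e := Real.rpow_pos_of_pos hK _
  rcases le_total e 0 with he | he
  · have h3 : 1 ≤ (1 + y) ^ |e| := Real.one_le_rpow (by linarith) (abs_nonneg _)
    calc w ^ e ≤ r ^ e := Real.rpow_le_rpow_of_nonpos hr h1 he
      _ ≤ (r ^ e + K ^ e) * 1 := by linarith
      _ ≤ _ := by gcongr
  · rw [abs_of_nonneg he]
    calc w ^ e ≤ (K * (1 + y)) ^ e := Real.rpow_le_rpow (hr.le.trans h1) h2 he
      _ = K ^ e * (1 + y) ^ e := Real.mul_rpow hK.le (by linarith)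
      _ ≤ _ := by gcongr; linarith

/-- Uniform decay in a cone of the integrand, with an arbitrary real exponent. -/
theorem IsCuspForm.exists_integrand_bound (hf : IsCuspForm N k f) (h4 : 4 ∣ N) (hk : 0 < k)
    (hγ : γ ∈ CongruenceSubgroup.Gamma0 N) (hc : γ 1 0 ≠ 0) (M e : ℝ) {r K : ℝ}
    (hr : 0 < r) (hK : 0 < K) :
    ∃ C : ℝ, ∀ y : ℝ, 0 < y → ∀ x : ℝ, |x - cuspPoint γ| ≤ M * y → ∀ z : ℂ,
      r ≤ ‖(⟨x, y⟩ : ℂ) - z‖ → ‖(⟨x, y⟩ : ℂ) - z‖ ≤ K * (1 + y) →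
      ‖f (UpperHalfPlane.ofComplex ⟨x, y⟩) * branchPow (γ 1 0) ((⟨x, y⟩ : ℂ) - z) (e : ℂ)‖ ≤
        C * (1 + y) ^ (-2 : ℝ) := by
  -- The power of `τ - z` grows at most like `(1 + y)^|e|`; the additional `2` leaves an integrable
  -- bound.
  obtain ⟨C, hC, h⟩ := hf.cone_bound h4 hk hγ hc M (|e| + 2) (by positivity)
  refine ⟨C * (r ^ e + K ^ e), fun y hy x hx z h1 h2 => ?_⟩
  rw [norm_mul, norm_branchPow]
  have h3 := rpow_le_mul_one_add_rpow e hr hK hy.le h1 h2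
  have hre : 0 < r ^ e := Real.rpow_pos_of_pos hr _
  have hKe : 0 < K ^ e := Real.rpow_pos_of_pos hK _
  calc _ ≤ (C * (1 + y) ^ (-(|e| + 2))) * ((r ^ e + K ^ e) * (1 + y) ^ |e|) :=
        mul_le_mul (h y hy x hx) h3 (by positivity) (by positivity)
    _ = C * (r ^ e + K ^ e) * ((1 + y) ^ (-(|e| + 2)) * (1 + y) ^ |e|) := by ring
    _ = _ := by
        rw [← Real.rpow_add (by linarith)]
        congr 2
        ring

theorem IsCuspForm.differentiableOn_periodIntegrand (hf : IsCuspForm N k f) (hc : γ 1 0 ≠ 0)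
    (z : ℂ) : DifferentiableOn ℂ (periodIntegrand k f γ z) (slitHalfPlane (γ 1 0) z) := by
  refine (hf.differentiableOn.mono fun τ hτ => hτ.1).mul fun τ hτ => ?_
  have h1 := hasDerivAt_branchPow hc ((k - 2 : ℝ) : ℂ) ((notMem_branchCut_iff hc).1 hτ.2)
  exact (h1.differentiableAt.comp τ
    (differentiableAt_id.sub_const z)).differentiableWithinAt

theorem cuspPoint_notMem_branchCut (hc : γ 1 0 ≠ 0) {z : ℂ} (hz : z ∈ cutPlane γ) :
    (cuspPoint γ : ℂ) ∉ branchCut (γ 1 0) z := by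
  rw [mem_branchCut_iff hc]
  rintro ⟨h1, h2⟩
  rw [Complex.ofReal_re] at h2
  rcases (mem_cutPlane_iff hc).1 hz with h | h
  · exact h (by rw [← h1, Complex.ofReal_im])
  · nlinarith

theorem norm_mk_sub_le {x x₀ y M : ℝ} (z : ℂ) (hy : 0 < y) (hx : |x - x₀| ≤ M * y) :
    ‖(⟨x, y⟩ : ℂ) - z‖ ≤ (|M| + 1 + ‖(x₀ : ℂ) - z‖) * (1 + y) := by
  have h1 := (norm_sub_le_of_cone hy (hx.trans (mul_le_mul_of_nonneg_right (le_abs_self M)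
    hy.le))).2
  calc ‖(⟨x, y⟩ : ℂ) - z‖ = ‖((⟨x, y⟩ : ℂ) - x₀) + (x₀ - z)‖ := by ring_nf
    _ ≤ (|M| + 1) * y + ‖(x₀ : ℂ) - z‖ := (norm_add_le _ _).trans (by gcongr)
    _ ≤ _ := by nlinarith [norm_nonneg ((x₀ : ℂ) - z), abs_nonneg M]

theorem IsCuspForm.coneBound_atTop (hf : IsCuspForm N k f) (h4 : 4 ∣ N) (hk : 0 < k)
    (hγ : γ ∈ CongruenceSubgroup.Gamma0 N) (hc : γ 1 0 ≠ 0) (z : ℂ) :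
    ConeBound (slitHalfPlane (γ 1 0) z) (periodIntegrand k f γ z) (cuspPoint γ) atTop := by
  intro M
  obtain ⟨C, hC⟩ := hf.exists_integrand_bound h4 hk hγ hc M (k - 2) one_pos
    (show 0 < |M| + 1 + ‖(cuspPoint γ : ℂ) - z‖ by positivity)
  refine ⟨C, ?_⟩
  filter_upwards [eventually_gt_atTop 0, eventually_ge_atTop (z.im + 1)] with y hy hy1 x hx
  refine ⟨⟨hy, fun h => ?_⟩, hC y hy x hx z ?_ (norm_mk_sub_le z hy hx)⟩
  · have : y = z.im := ((mem_branchCut_iff hc).1 h).1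
    linarith
  · have := Complex.abs_im_le_norm ((⟨x, y⟩ : ℂ) - z)
    simp only [Complex.sub_im] at this
    linarith [le_abs_self (y - z.im)]

theorem IsCuspForm.coneBound_zero (hf : IsCuspForm N k f) (h4 : 4 ∣ N) (hk : 0 < k)
    (hγ : γ ∈ CongruenceSubgroup.Gamma0 N) (hc : γ 1 0 ≠ 0) {z : ℂ} (hz : z ∈ cutPlane γ) :
    ConeBound (slitHalfPlane (γ 1 0) z) (periodIntegrand k f γ z) (cuspPoint γ) (𝓝[>] 0) := by
  intro M
  have h0 := (notMem_branchCut_iff hc).1 (cuspPoint_notMem_branchCut hc hz)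
  have hopen : IsOpen {τ : ℂ | -((γ 1 0).sign : ℂ) * (τ - z) ∈ Complex.slitPlane} :=
    Complex.isOpen_slitPlane.preimage (by fun_prop)
  obtain ⟨r, hr, hball⟩ := Metric.isOpen_iff.1 hopen _ h0
  -- The point `z` lies on its own cut, hence outside the ball; points within `r / 2` of the cusp
  -- then stay at distance at least `r / 2` from `z`.
  have hne : z ∉ Metric.ball (cuspPoint γ : ℂ) r := fun h => by
    have := hball h
    simp at this
  obtain ⟨C, hC⟩ := hf.exists_integrand_bound h4 hk hγ hc M (k - 2) (half_pos hr)
    (show 0 < |M| + 1 + ‖(cuspPoint γ : ℂ) - z‖ by positivity)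
  refine ⟨C, ?_⟩
  have ha : 0 < r / 2 / (|M| + 1) := by positivity
  filter_upwards [Ioo_mem_nhdsGT ha] with y hy x hx
  have h1 := (norm_sub_le_of_cone hy.1 (hx.trans (mul_le_mul_of_nonneg_right (le_abs_self M)
    hy.1.le))).2
  have h2 : ‖(⟨x, y⟩ : ℂ) - cuspPoint γ‖ < r / 2 := by
    refine h1.trans_lt ?_
    rw [← lt_div_iff₀' (by positivity)]
    exact hy.2
  refine ⟨⟨hy.1, (notMem_branchCut_iff hc).2 (hball ?_)⟩,
    hC y hy.1 x hx z ?_ (norm_mk_sub_le z hy.1 hx)⟩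
  · rw [Metric.mem_ball, dist_eq_norm]; linarith
  · rw [Metric.mem_ball, dist_eq_norm, not_lt] at hne
    have h3 : z - cuspPoint γ = ((⟨x, y⟩ : ℂ) - cuspPoint γ) - ((⟨x, y⟩ : ℂ) - z) := by ring
    have := norm_sub_le ((⟨x, y⟩ : ℂ) - cuspPoint γ) ((⟨x, y⟩ : ℂ) - z)
    rw [← h3] at this
    linarith

/-! ### The period integral as an analytic function on the cut plane -/

variable (k f γ) in
/-- The common value of the integral over all admissible paths. -/
noncomputable def periodIntegral (z : ℂ) : ℂ :=
  Classical.epsilon fun J => ∀ p : ℝ → ℂ, IsAdmissiblePath γ z p →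
    HasContourIntegral (periodIntegrand k f γ z) p J

theorem IsCuspForm.hasContourIntegral_periodIntegral (hf : IsCuspForm N k f) (h4 : 4 ∣ N)
    (hk : 0 < k) (hγ : γ ∈ CongruenceSubgroup.Gamma0 N) (hc : γ 1 0 ≠ 0) {z : ℂ}
    (hz : z ∈ cutPlane γ) {p : ℝ → ℂ} (hp : IsAdmissiblePath γ z p) :
    HasContourIntegral (periodIntegrand k f γ z) p (periodIntegral k f γ z) :=
  Classical.epsilon_spec (exists_hasContourIntegral hc (hf.differentiableOn_periodIntegrand hc z)
    (hf.coneBound_zero h4 hk hγ hc hz) (hf.coneBound_atTop h4 hk hγ hc z)) p hp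

/-- The ray from `-d/c` with direction `i - M sign(c)`. -/
noncomputable def ray (γ : SL(2, ℤ)) (M t : ℝ) : ℂ :=
  ⟨cuspPoint γ - M * (γ 1 0).sign * t, t⟩

/-- The set of all `z` whose branch cut is not met by the ray. -/
def rayDomain (γ : SL(2, ℤ)) (M : ℝ) : Set ℂ :=
  {z | 0 < ((γ 1 0).sign : ℝ) * (z.re - cuspPoint γ) + M * z.im ∨ z.im < 0}

theorem isOpen_rayDomain (M : ℝ) : IsOpen (rayDomain γ M) :=
  IsOpen.union (s₁ := {z : ℂ | 0 < ((γ 1 0).sign : ℝ) * (z.re - cuspPoint γ) + M * z.im})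
    (isOpen_lt continuous_const (by fun_prop)) (isOpen_lt Complex.continuous_im continuous_const)

theorem sign_mul_sign (hc : γ 1 0 ≠ 0) : ((γ 1 0).sign : ℝ) * ((γ 1 0).sign : ℝ) = 1 := by
  rcases lt_or_gt_of_ne hc with h | h
  · simp [Int.sign_eq_neg_one_of_neg h]
  · simp [Int.sign_eq_one_of_pos h]

theorem exists_mem_rayDomain (hc : γ 1 0 ≠ 0) {z : ℂ} (hz : z ∈ cutPlane γ) :
    ∃ M, z ∈ rayDomain γ M := by
  rw [mem_cutPlane_iff hc] at hz
  rcases lt_trichotomy z.im 0 with h | h | h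
  · exact ⟨0, Or.inr h⟩
  · exact ⟨0, Or.inl (by simpa using hz.resolve_left (not_not.2 h))⟩
  · refine ⟨(1 - ((γ 1 0).sign : ℝ) * (z.re - cuspPoint γ)) / z.im, Or.inl ?_⟩
    rw [div_mul_cancel₀ _ h.ne']
    linarith

theorem rayDomain_subset_cutPlane (hc : γ 1 0 ≠ 0) (M : ℝ) : rayDomain γ M ⊆ cutPlane γ := by
  rintro z hz
  rw [mem_cutPlane_iff hc]
  by_cases h : z.im = 0
  · refine Or.inr ?_
    rcases hz with h1 | h1
    · simpa [h] using h1
    · exact absurd h h1.ne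
  · exact Or.inl h

/-- Used for distances: a ball inside `rayDomain` cannot meet the ray, so the ray stays at least its
radius away from its centre. -/
theorem ray_notMem_rayDomain (hc : γ 1 0 ≠ 0) (M : ℝ) {t : ℝ} (ht : 0 ≤ t) :
    ray γ M t ∉ rayDomain γ M := by
  rintro (h | h)
  · have h1 := sign_mul_sign hc
    have h2 : ((γ 1 0).sign : ℝ) * ((ray γ M t).re - cuspPoint γ) + M * (ray γ M t).im =
      M * t * (1 - (γ 1 0).sign * (γ 1 0).sign) := by simp only [ray]; ring
    rw [h2, h1] at h
    simp at h
  · exact absurd h (not_lt.2 ht)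

theorem ray_notMem_branchCut (hc : γ 1 0 ≠ 0) {M : ℝ} {z : ℂ} (hz : z ∈ rayDomain γ M) {t : ℝ}
    (ht : 0 ≤ t) : ray γ M t ∉ branchCut (γ 1 0) z := by
  rw [mem_branchCut_iff hc]
  rintro ⟨h1, h2⟩
  simp only [ray] at h1 h2
  rcases hz with h | h
  · have h3 : ((γ 1 0).sign : ℝ) * (cuspPoint γ - M * (γ 1 0).sign * t - z.re) =
      -(((γ 1 0).sign : ℝ) * (z.re - cuspPoint γ) + M * t * ((γ 1 0).sign * (γ 1 0).sign)) := by
      ring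
    rw [h3, sign_mul_sign hc, mul_one, h1] at h2
    linarith
  · linarith

theorem ray_eq (γ : SL(2, ℤ)) (M t : ℝ) :
    ray γ M t = cuspPoint γ + t * (Complex.I - (M * (γ 1 0).sign : ℝ)) := by
  apply Complex.ext <;> simp [ray]; ring

theorem hasDerivAt_ray (γ : SL(2, ℤ)) (M t : ℝ) :
    HasDerivAt (ray γ M) (Complex.I - (M * (γ 1 0).sign : ℝ)) t := by
  have h : ray γ M = fun t : ℝ => (cuspPoint γ : ℂ) + t * (Complex.I - (M * (γ 1 0).sign : ℝ)) :=
    funext (ray_eq γ M)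
  rw [h]
  simpa using ((Complex.ofRealCLM.hasDerivAt (x := t)).mul_const
    (Complex.I - ((M * (γ 1 0).sign : ℝ) : ℂ))).const_add (cuspPoint γ : ℂ)

theorem abs_ray_sub (hc : γ 1 0 ≠ 0) (M : ℝ) {t : ℝ} (ht : 0 ≤ t) :
    |cuspPoint γ - M * (γ 1 0).sign * t - cuspPoint γ| ≤ |M| * t := by
  have : |((γ 1 0).sign : ℝ)| = 1 := by
    rcases lt_or_gt_of_ne hc with h | h
    · simp [Int.sign_eq_neg_one_of_neg h]
    · simp [Int.sign_eq_one_of_pos h]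
  rw [sub_sub_cancel_left, abs_neg, abs_mul, abs_mul, this, mul_one, abs_of_nonneg ht]

theorem isAdmissiblePath_ray (hc : γ 1 0 ≠ 0) {M : ℝ} {z : ℂ} (hz : z ∈ rayDomain γ M) :
    IsAdmissiblePath γ z (ray γ M) where
  cont t _ := (hasDerivAt_ray γ M t).continuousAt.continuousWithinAt
  diff := ⟨∅, countable_empty, fun t _ _ => (hasDerivAt_ray γ M t).differentiableAt⟩
  deriv_int := by
    rw [funext fun t => (hasDerivAt_ray γ M t).deriv]
    exact continuous_const.locallyIntegrable.locallyIntegrableOn _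
  im_pos t ht := ht
  avoids t ht := ray_notMem_branchCut hc hz ht.le
  start := by
    have h := (hasDerivAt_ray γ M 0).continuousAt.tendsto.mono_left
      (nhdsWithin_le_nhds (s := Ioi 0))
    rw [ray_eq] at h
    simpa [cuspPoint] using h
  start_cone := by
    refine ⟨|M|, ?_⟩
    filter_upwards [self_mem_nhdsWithin] with t ht using abs_ray_sub hc M (le_of_lt ht)
  finish := tendsto_id
  finish_cone := by
    refine ⟨|M| + |cuspPoint γ|, ?_⟩
    filter_upwards [eventually_ge_atTop 1] with t ht
    have h1 := abs_ray_sub hc M (zero_le_one.trans ht)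
    have h2 := abs_add_le (cuspPoint γ - M * (γ 1 0).sign * t - cuspPoint γ) (cuspPoint γ)
    rw [sub_add_cancel] at h2
    change |cuspPoint γ - M * (γ 1 0).sign * t| ≤ (|M| + |cuspPoint γ|) * t
    nlinarith [abs_nonneg (cuspPoint γ)]

theorem exists_isAdmissiblePath (hc : γ 1 0 ≠ 0) {z : ℂ} (hz : z ∈ cutPlane γ) :
    ∃ p, IsAdmissiblePath γ z p := by
  obtain ⟨M, hM⟩ := exists_mem_rayDomain hc hz
  exact ⟨_, isAdmissiblePath_ray hc hM⟩

/-- Identifies the two-sided improper integral of `HasContourIntegral` with a Lebesgue integral, to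
which dominated convergence applies. -/
theorem tendsto_intervalIntegral_Ioi_zero {g : ℝ → ℂ} (hg : IntegrableOn g (Ioi 0)) :
    Tendsto (fun x : ℝ × ℝ => ∫ t in x.1..x.2, g t) (𝓝[>] 0 ×ˢ atTop)
      (𝓝 (∫ t in Ioi 0, g t)) := by
  have h1 := intervalIntegral_tendsto_integral_Ioi (l := atTop) (b := id) 0 hg tendsto_id
  have hi : ∀ b : ℝ, 0 ≤ b → IntervalIntegrable g volume 0 b := fun b hb =>
    (intervalIntegrable_iff_integrableOn_Ioc_of_le hb).2 (hg.mono_set fun t ht => ht.1)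
  have h2 : Tendsto (fun a : ℝ => ∫ t in (0 : ℝ)..a, g t) (𝓝[>] 0) (𝓝 0) := by
    have h3 := intervalIntegral.continuousOn_primitive_interval' (hi 1 zero_le_one)
      (a := 0) (by simp) 0 (by simp)
    rw [ContinuousWithinAt, intervalIntegral.integral_same, uIcc_of_le zero_le_one] at h3
    rw [← nhdsWithin_Ioc_eq_nhdsGT (zero_lt_one' ℝ)]
    exact h3.mono_left (nhdsWithin_mono _ Ioc_subset_Icc_self)
  have h4 := (h1.comp tendsto_snd).sub (h2.comp tendsto_fst)
  rw [sub_zero] at h4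
  refine h4.congr' ?_
  have h5 : ∀ᶠ x : ℝ × ℝ in 𝓝[>] 0 ×ˢ atTop, 0 < x.1 ∧ 0 < x.2 :=
    (eventually_mem_nhdsWithin (s := Ioi (0 : ℝ))).prod_mk (eventually_gt_atTop 0)
  filter_upwards [h5] with x hx
  exact intervalIntegral.integral_interval_sub_left (hi _ hx.2.le) (hi _ hx.1.le)

theorem IsCuspForm.continuousOn_comp_ray (hf : IsCuspForm N k f) (M : ℝ) :
    ContinuousOn (fun t => f (UpperHalfPlane.ofComplex (ray γ M t))) (Ioi 0) :=
  hf.differentiableOn.continuousOn.comp (f := ray γ M)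
    (fun t _ => (hasDerivAt_ray γ M t).continuousAt.continuousWithinAt) fun _ ht => ht

theorem continuousOn_branchPow_ray (hc : γ 1 0 ≠ 0) {M : ℝ} {z : ℂ}
    (hz : z ∈ rayDomain γ M) (e : ℂ) :
    ContinuousOn (fun t => branchPow (γ 1 0) (ray γ M t - z) e) (Ioi 0) := fun t ht => by
  have h1 := (hasDerivAt_branchPow hc e ((notMem_branchCut_iff hc).1
    (ray_notMem_branchCut hc hz (le_of_lt ht)))).continuousAt
  exact (h1.comp (f := fun t => ray γ M t - z)
    ((hasDerivAt_ray γ M t).continuousAt.sub continuousAt_const)).continuousWithinAt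

/-- Locally uniform bound of the integrand on a ray. -/
theorem IsCuspForm.exists_ray_bound (hf : IsCuspForm N k f) (h4 : 4 ∣ N) (hk : 0 < k)
    (hγ : γ ∈ CongruenceSubgroup.Gamma0 N) (hc : γ 1 0 ≠ 0) (M e : ℝ) {z₀ : ℂ}
    (hz : z₀ ∈ rayDomain γ M) : ∃ r > 0, Metric.ball z₀ r ⊆ rayDomain γ M ∧
      ∃ C, ∀ t > 0, ∀ z ∈ Metric.ball z₀ r,
        ‖f (UpperHalfPlane.ofComplex (ray γ M t)) * branchPow (γ 1 0) (ray γ M t - z) (e : ℂ)‖ ≤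
          C * (1 + t) ^ (-2 : ℝ) := by
  obtain ⟨R, hR, hball⟩ := Metric.isOpen_iff.1 (isOpen_rayDomain M) _ hz
  have hr : 0 < R / 2 := half_pos hR
  set K := |(|M|)| + 1 + (‖(cuspPoint γ : ℂ) - z₀‖ + R) with hK
  obtain ⟨C, hC⟩ := hf.exists_integrand_bound h4 hk hγ hc |M| e hr
    (show 0 < K by positivity)
  refine ⟨R / 2, hr, (Metric.ball_subset_ball (by linarith)).trans hball, C, fun t ht z hz' => ?_⟩
  rw [Metric.mem_ball, dist_eq_norm] at hz'
  have hx := abs_ray_sub hc M (le_of_lt ht)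
  refine hC t ht _ hx z ?_ ((norm_mk_sub_le z ht hx).trans ?_)
  · have h1 : R ≤ ‖ray γ M t - z₀‖ := by
      by_contra! h
      exact ray_notMem_rayDomain hc M ht.le (hball (by rwa [Metric.mem_ball, dist_eq_norm]))
    have h2 := norm_add_le (ray γ M t - z) (z - z₀)
    rw [sub_add_sub_cancel] at h2
    change R / 2 ≤ ‖ray γ M t - z‖
    linarith
  · have h2 := norm_sub_le ((cuspPoint γ : ℂ) - z₀) (z - z₀)
    rw [sub_sub_sub_cancel_right] at h2
    have h3 : ‖(cuspPoint γ : ℂ) - z‖ ≤ ‖(cuspPoint γ : ℂ) - z₀‖ + R := by linarith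
    have : 0 < 1 + t := by linarith
    rw [hK]
    gcongr

theorem integrableOn_one_add_rpow (C : ℝ) :
    IntegrableOn (fun t : ℝ => C * (1 + t) ^ (-2 : ℝ)) (Ioi 0) := by
  have h := (integrableOn_add_rpow_Ioi_of_lt (a := -2) (c := 0) (m := 1) (by norm_num)
    (by norm_num)).const_mul C
  simpa only [IntegrableOn, add_comm] using h

theorem IsCuspForm.integrableOn_ray (hf : IsCuspForm N k f) (h4 : 4 ∣ N) (hk : 0 < k)
    (hγ : γ ∈ CongruenceSubgroup.Gamma0 N) (hc : γ 1 0 ≠ 0) {M : ℝ} {z : ℂ}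
    (hz : z ∈ rayDomain γ M) :
    IntegrableOn (fun t => periodIntegrand k f γ z (ray γ M t)) (Ioi 0) := by
  obtain ⟨r, hr, -, C, hC⟩ := hf.exists_ray_bound h4 hk hγ hc M (k - 2) hz
  refine Integrable.mono' (integrableOn_one_add_rpow C)
    (((hf.continuousOn_comp_ray M).mul (continuousOn_branchPow_ray hc hz _)).aestronglyMeasurable
      measurableSet_Ioi) ?_
  exact (ae_restrict_iff' measurableSet_Ioi).2
    (ae_of_all _ fun t ht => hC t ht z (Metric.mem_ball_self hr))

/-- The same ray serves every `z` in the open set `rayDomain γ M`, so locally the path of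
integration does not depend on `z`. -/
theorem IsCuspForm.periodIntegral_eq (hf : IsCuspForm N k f) (h4 : 4 ∣ N) (hk : 0 < k)
    (hγ : γ ∈ CongruenceSubgroup.Gamma0 N) (hc : γ 1 0 ≠ 0) {M : ℝ} {z : ℂ}
    (hz : z ∈ rayDomain γ M) :
    periodIntegral k f γ z = ∫ t in Ioi (0 : ℝ),
      periodIntegrand k f γ z (ray γ M t) * (Complex.I - (M * (γ 1 0).sign : ℝ)) := by
  have h1 := hf.hasContourIntegral_periodIntegral h4 hk hγ hc (rayDomain_subset_cutPlane hc M hz)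
    (isAdmissiblePath_ray hc hz)
  have h2 := tendsto_intervalIntegral_Ioi_zero ((hf.integrableOn_ray h4 hk hγ hc hz).mul_const
    (Complex.I - (M * (γ 1 0).sign : ℝ)))
  unfold HasContourIntegral at h1
  simp_rw [(hasDerivAt_ray γ M _).deriv] at h1
  exact tendsto_nhds_unique h1 h2

theorem IsCuspForm.differentiableAt_periodIntegral (hf : IsCuspForm N k f) (h4 : 4 ∣ N)
    (hk : 0 < k) (hγ : γ ∈ CongruenceSubgroup.Gamma0 N) (hc : γ 1 0 ≠ 0) {z₀ : ℂ}
    (hz : z₀ ∈ cutPlane γ) : DifferentiableAt ℂ (periodIntegral k f γ) z₀ := by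
  obtain ⟨M, hM⟩ := exists_mem_rayDomain hc hz
  set v : ℂ := Complex.I - (M * (γ 1 0).sign : ℝ) with hv
  have heq : periodIntegral k f γ =ᶠ[𝓝 z₀] fun z => ∫ t in Ioi (0 : ℝ),
      periodIntegrand k f γ z (ray γ M t) * v := by
    filter_upwards [(isOpen_rayDomain M).mem_nhds hM] with z hz using
      hf.periodIntegral_eq h4 hk hγ hc hz
  refine DifferentiableAt.congr_of_eventuallyEq ?_ heq
  -- Differentiation in `z` lowers the exponent to `k - 3`; the bound is uniform for `z` in a small
  -- ball.
  obtain ⟨r, hr, hball, C, hC⟩ := hf.exists_ray_bound h4 hk hγ hc M (k - 2 - 1) hM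
  have hs : ((k - 2 - 1 : ℝ) : ℂ) = ((k - 2 : ℝ) : ℂ) - 1 := by push_cast; ring
  rw [hs] at hC
  have hmeas : ∀ e : ℂ, ∀ z ∈ rayDomain γ M, ContinuousOn (fun t =>
      f (UpperHalfPlane.ofComplex (ray γ M t)) * branchPow (γ 1 0) (ray γ M t - z) e) (Ioi 0) :=
    fun e z hz => (hf.continuousOn_comp_ray M).mul (continuousOn_branchPow_ray hc hz e)
  refine (hasDerivAt_integral_of_dominated_loc_of_deriv_le
    (F' := fun z t => f (UpperHalfPlane.ofComplex (ray γ M t)) *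
      branchPow (γ 1 0) (ray γ M t - z) (((k - 2 : ℝ) : ℂ) - 1) * (-((k - 2 : ℝ) : ℂ) * v))
    (bound := fun t => C * (1 + t) ^ (-2 : ℝ) * ‖-((k - 2 : ℝ) : ℂ) * v‖)
    (Metric.ball_mem_nhds z₀ hr) ?_ ?_ ?_ ?_ ?_ ?_).2.differentiableAt
  · filter_upwards [(isOpen_rayDomain M).mem_nhds hM] with z hz
    exact ((hmeas _ z hz).mul continuousOn_const).aestronglyMeasurable measurableSet_Ioi
  · exact (hf.integrableOn_ray h4 hk hγ hc hM).mul_const v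
  · exact ((hmeas _ z₀ hM).mul continuousOn_const).aestronglyMeasurable measurableSet_Ioi
  · refine (ae_restrict_iff' measurableSet_Ioi).2 (ae_of_all _ fun t ht z hz => ?_)
    rw [norm_mul]
    exact mul_le_mul_of_nonneg_right (hC t ht z hz) (norm_nonneg _)
  · exact (integrableOn_one_add_rpow C).mul_const _
  · refine (ae_restrict_iff' measurableSet_Ioi).2 (ae_of_all _ fun t ht z hz => ?_)
    have h1 := hasDerivAt_branchPow hc ((k - 2 : ℝ) : ℂ) ((notMem_branchCut_iff hc).1
      (ray_notMem_branchCut hc (hball hz) (le_of_lt ht)))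
    have h2 := h1.comp z ((hasDerivAt_id z).const_sub (ray γ M t))
    have h3 := (h2.const_mul (f (UpperHalfPlane.ofComplex (ray γ M t)))).mul_const v
    refine h3.congr_deriv ?_
    ring

theorem isOpen_cutPlane (γ : SL(2, ℤ)) : IsOpen (cutPlane γ) :=
  Complex.isOpen_slitPlane.preimage (by unfold autFactor; fun_prop)

theorem IsCuspForm.analyticOnNhd_periodIntegral (hf : IsCuspForm N k f) (h4 : 4 ∣ N)
    (hk : 0 < k) (hγ : γ ∈ CongruenceSubgroup.Gamma0 N) (hc : γ 1 0 ≠ 0) :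
    AnalyticOnNhd ℂ (periodIntegral k f γ) (cutPlane γ) :=
  DifferentiableOn.analyticOnNhd (fun _ hz =>
    (hf.differentiableAt_periodIntegral h4 hk hγ hc hz).differentiableWithinAt) (isOpen_cutPlane γ)

/-! ### Fourier expansion and the Eichler integral -/

theorem kronecker_zero_one : kronecker 0 1 = 1 := by simp [kronecker]

theorem slash_of_eq_zero_of_eq_one (κ : ℝ) (hc : γ 1 0 = 0) (hd : γ 1 1 = 1)
    (g : UpperHalfPlane → ℂ) (z : UpperHalfPlane) : slash κ γ g z = g (γ • z) := by
  simp [slash, hc, hd, kronecker_zero_one, autFactor, epsilonFactor]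

theorem IsCuspForm.periodic (hf : IsCuspForm N k f) :
    Function.Periodic (f ∘ UpperHalfPlane.ofComplex) ((1 : ℝ) : ℂ) := by
  intro w
  by_cases! hw : 0 < w.im
  · have hw' : 0 < (w + (1 : ℝ)).im := by simpa using hw
    simp only [Function.comp, UpperHalfPlane.ofComplex_apply_of_im_pos hw,
      UpperHalfPlane.ofComplex_apply_of_im_pos hw']
    have hT : ModularGroup.T ∈ CongruenceSubgroup.Gamma0 N := by
      rw [CongruenceSubgroup.Gamma0_mem]; simp [ModularGroup.T]
    rw [hf.slash_eq _ hT ⟨w, hw⟩, slash_of_eq_zero_of_eq_one k (by simp [ModularGroup.T])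
      (by simp [ModularGroup.T]), UpperHalfPlane.modular_T_smul]
    congr 1
    ext
    simp [UpperHalfPlane.coe_vadd, add_comm]
  -- Off the upper half-plane `ofComplex` takes one fixed default value.
  · have hw' : (w + (1 : ℝ)).im ≤ 0 := by simpa using hw
    simp only [Function.comp, UpperHalfPlane.ofComplex_apply_of_im_nonpos hw,
      UpperHalfPlane.ofComplex_apply_of_im_nonpos hw']

theorem IsCuspForm.isZeroAtImInfty (hf : IsCuspForm N k f) :
    UpperHalfPlane.IsZeroAtImInfty f := by
  obtain ⟨δ, hδ, h⟩ := hf.isBigO_exp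
  refine h.trans_tendsto ?_
  refine Real.tendsto_exp_atBot.comp ?_
  exact Tendsto.const_mul_atTop_of_neg (neg_lt_zero.2 hδ) tendsto_comap

theorem IsCuspForm.isBoundedAtImInfty (hf : IsCuspForm N k f) :
    UpperHalfPlane.IsBoundedAtImInfty f :=
  Tendsto.isBigO_one ℝ hf.isZeroAtImInfty

/-- The coefficients `a_{n+1}`. -/
noncomputable def fourierCoeff (f : UpperHalfPlane → ℂ) (n : ℕ) : ℂ :=
  (UpperHalfPlane.qExpansion 1 f).coeff (n + 1)

theorem IsCuspForm.hasSum (hf : IsCuspForm N k f) (z : UpperHalfPlane) :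
    HasSum (fun n : ℕ => fourierCoeff f n *
      Complex.exp (2 * Real.pi * Complex.I * ((n + 1 : ℕ) : ℂ) * z)) (f z) := by
  have h := UpperHalfPlane.hasSum_qExpansion one_pos hf.periodic hf.holo hf.isBoundedAtImInfty z
  have h0 : (UpperHalfPlane.qExpansion 1 f).coeff 0 = 0 := by
    rw [UpperHalfPlane.qExpansion_coeff_zero one_pos (UpperHalfPlane.analyticAt_cuspFunction_zero
      one_pos hf.periodic hf.holo hf.isBoundedAtImInfty) hf.periodic,
      hf.isZeroAtImInfty.valueAtInfty_eq_zero]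
  rw [← hasSum_nat_add_iff' 1] at h
  simp only [Finset.range_one, Finset.sum_singleton, h0, smul_eq_mul, zero_mul, sub_zero] at h
  refine h.congr_fun fun n => ?_
  rw [fourierCoeff, Function.Periodic.qParam, ← Complex.exp_nat_mul]
  congr 2
  push_cast; ring

/-- The Eichler integral as a function of a complex variable. -/
noncomputable def eichlerSeries (k : ℝ) (f : UpperHalfPlane → ℂ) (z : ℂ) : ℂ :=
  ∑' n : ℕ, fourierCoeff f n * ((n + 1 : ℕ) : ℂ) ^ ((1 - k : ℝ) : ℂ) *
    Complex.exp (2 * Real.pi * Complex.I * ((n + 1 : ℕ) : ℂ) * z)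

theorem eichlerIntegral_eq (k : ℝ) (f : UpperHalfPlane → ℂ) (z : UpperHalfPlane) :
    eichlerIntegral k f z = eichlerSeries k f z := rfl

theorem norm_natCast_cpow_le (hk : 1 ≤ k) (n : ℕ) :
    ‖((n + 1 : ℕ) : ℂ) ^ ((1 - k : ℝ) : ℂ)‖ ≤ 1 := by
  rw [Complex.norm_cpow_real, Complex.norm_natCast]
  exact Real.rpow_le_one_of_one_le_of_nonpos (by simp) (by linarith)

theorem norm_exp_two_pi_mul (n : ℕ) (z : ℂ) :
    ‖Complex.exp (2 * Real.pi * Complex.I * ((n + 1 : ℕ) : ℂ) * z)‖ =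
      Real.exp (-(2 * Real.pi * (n + 1 : ℕ) * z.im)) := by
  rw [Complex.norm_exp]
  congr 1
  have : 2 * Real.pi * Complex.I * ((n + 1 : ℕ) : ℂ) * z =
    ((2 * Real.pi * (n + 1 : ℕ) : ℝ) : ℂ) * (Complex.I * z) := by push_cast; ring
  rw [this, Complex.re_ofReal_mul, Complex.I_mul_re]
  ring

/-- The factors `n^{1-k}` are at most `1`, so the absolutely convergent series of `f` at height `Im
z / 2` dominates near `z`. -/
theorem IsCuspForm.differentiableOn_eichlerSeries (hf : IsCuspForm N k f) (hk : 1 ≤ k) :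
    DifferentiableOn ℂ (eichlerSeries k f) {z | 0 < z.im} := by
  intro z hz
  rw [mem_ofPred_eq] at hz
  have hopen : IsOpen {w : ℂ | z.im / 2 < w.im} := isOpen_lt continuous_const Complex.continuous_im
  have hz2 : 0 < z.im / 2 := half_pos hz
  have hsum := (hf.hasSum ⟨⟨0, z.im / 2⟩, hz2⟩).summable.norm
  refine ((Complex.differentiableOn_tsum_of_summable_norm hsum (fun n => ?_) hopen
    fun n w hw => ?_).differentiableAt (hopen.mem_nhds (half_lt_self hz))).differentiableWithinAt
  · fun_prop
  · rw [norm_mul, norm_mul, norm_mul, norm_exp_two_pi_mul, norm_exp_two_pi_mul]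
    have h1 := norm_natCast_cpow_le hk n
    have h2 : Real.exp (-(2 * Real.pi * (n + 1 : ℕ) * w.im)) ≤
        Real.exp (-(2 * Real.pi * (n + 1 : ℕ) * (z.im / 2))) := by
      refine Real.exp_le_exp.2 (neg_le_neg ?_)
      have : z.im / 2 < w.im := hw
      gcongr
    calc _ ≤ ‖fourierCoeff f n‖ * 1 * Real.exp (-(2 * Real.pi * (n + 1 : ℕ) * (z.im / 2))) := by
          gcongr
      _ = _ := by rw [mul_one]

theorem IsCuspForm.mdifferentiable_eichlerIntegral (hf : IsCuspForm N k f) (hk : 1 ≤ k) :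
    MDifferentiable 𝓘(ℂ) 𝓘(ℂ) (eichlerIntegral k f) := by
  rw [UpperHalfPlane.mdifferentiable_iff]
  refine (hf.differentiableOn_eichlerSeries hk).congr fun z hz => ?_
  simp only [Function.comp, eichlerIntegral_eq, UpperHalfPlane.ofComplex_apply_of_im_pos hz]

theorem eichlerSeries_add_int (k : ℝ) (f : UpperHalfPlane → ℂ) (z : ℂ) (b : ℤ) :
    eichlerSeries k f (z + b) = eichlerSeries k f z := by
  unfold eichlerSeries
  congr 1
  ext n
  congr 1
  have : 2 * Real.pi * Complex.I * ((n + 1 : ℕ) : ℂ) * (z + b) =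
    2 * Real.pi * Complex.I * ((n + 1 : ℕ) : ℂ) * z +
      (((n + 1 : ℕ) * b : ℤ) : ℂ) * (2 * Real.pi * Complex.I) := by push_cast; ring
  rw [this, Complex.exp_add, Complex.exp_int_mul_two_pi_mul_I, mul_one]

/-- The Eichler integral is a Mellin transform. -/
theorem IsCuspForm.eichlerSeries_eq_integral (hf : IsCuspForm N k f) (hk : 1 < k) {z : ℂ}
    (hz : 0 < z.im) :
    eichlerSeries k f z = ((2 * Real.pi : ℝ) : ℂ) ^ ((k - 1 : ℝ) : ℂ) / Complex.Gamma (k - 1) *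
      ∫ u in Ioi (0 : ℝ), ((u : ℝ) : ℂ) ^ ((k - 2 : ℝ) : ℂ) *
        f (UpperHalfPlane.ofComplex (z + u * Complex.I)) := by
  have hre : (((k - 1 : ℝ) : ℂ)).re = k - 1 := Complex.ofReal_re _
  have hp : ∀ n : ℕ, 0 < 2 * Real.pi * ((n + 1 : ℕ) : ℝ) := fun n => by positivity
  -- Termwise Mellin transform at `s = k - 1`, with `u ↦ f(z + iu)` expanded in the exponentials
  -- `e^{-2πnu}`.
  have h := hasSum_mellin
    (a := fun n : ℕ => fourierCoeff f n *
      Complex.exp (2 * Real.pi * Complex.I * ((n + 1 : ℕ) : ℂ) * z))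
    (p := fun n : ℕ => 2 * Real.pi * ((n + 1 : ℕ) : ℝ))
    (F := fun u : ℝ => f (UpperHalfPlane.ofComplex (z + u * Complex.I)))
    (s := ((k - 1 : ℝ) : ℂ)) (fun n => Or.inr (hp n)) (by rw [hre]; linarith) ?_ ?_
  · have hΓ : Complex.Gamma ((k : ℂ) - 1) ≠ 0 := by
      have := Complex.Gamma_ne_zero_of_re_pos (s := ((k - 1 : ℝ) : ℂ)) (by rw [hre]; linarith)
      simpa using this
    have hpi : ((2 * Real.pi : ℝ) : ℂ) ^ ((k - 1 : ℝ) : ℂ) ≠ 0 :=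
      (Complex.cpow_ne_zero_iff_of_exponent_ne_zero (by
        exact_mod_cast (by linarith : k - 1 ≠ 0))).2 (by
          exact_mod_cast (by positivity : 2 * Real.pi ≠ 0))
    have h2 := h.mul_left (((2 * Real.pi : ℝ) : ℂ) ^ ((k - 1 : ℝ) : ℂ) / Complex.Gamma (k - 1))
    have hmel : mellin (fun u : ℝ => f (UpperHalfPlane.ofComplex (z + u * Complex.I)))
        ((k - 1 : ℝ) : ℂ) = ∫ u in Ioi (0 : ℝ), ((u : ℝ) : ℂ) ^ ((k - 2 : ℝ) : ℂ) *
        f (UpperHalfPlane.ofComplex (z + u * Complex.I)) := by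
      have : ((k - 1 : ℝ) : ℂ) - 1 = ((k - 2 : ℝ) : ℂ) := by push_cast; ring
      simp only [mellin, this, smul_eq_mul]
    rw [hmel] at h2
    rw [← h2.tsum_eq, eichlerSeries]
    congr 1
    ext n
    have h3 : ((2 * Real.pi * ((n + 1 : ℕ) : ℝ) : ℝ) : ℂ) ^ ((k - 1 : ℝ) : ℂ) =
        ((2 * Real.pi : ℝ) : ℂ) ^ ((k - 1 : ℝ) : ℂ) * ((n + 1 : ℕ) : ℂ) ^ ((k - 1 : ℝ) : ℂ) := by
      rw [Complex.ofReal_mul, Complex.mul_cpow_ofReal_nonneg (by positivity) (by positivity)]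
      simp
    have h4 : ((n + 1 : ℕ) : ℂ) ^ ((1 - k : ℝ) : ℂ) = (((n + 1 : ℕ) : ℂ) ^ ((k - 1 : ℝ) : ℂ))⁻¹ := by
      rw [← Complex.cpow_neg]; congr 1; push_cast; ring
    have h5 : ((k - 1 : ℝ) : ℂ) = (k : ℂ) - 1 := by push_cast; ring
    have h6 : ((n + 1 : ℕ) : ℂ) ^ ((k - 1 : ℝ) : ℂ) ≠ 0 :=
      (Complex.cpow_ne_zero_iff_of_exponent_ne_zero (by
        exact_mod_cast (by linarith : k - 1 ≠ 0))).2 (by exact_mod_cast n.succ_ne_zero)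
    rw [h3, h4]
    rw [h5] at *
    field_simp
  · intro u hu
    rw [mem_Ioi] at hu
    have him : 0 < (z + u * Complex.I).im := by simp; linarith
    rw [UpperHalfPlane.ofComplex_apply_of_im_pos him]
    refine (hf.hasSum ⟨_, him⟩).congr_fun fun n => ?_
    rw [mul_assoc, Complex.ofReal_exp, ← Complex.exp_add]
    congr 2
    push_cast
    linear_combination (-2 * Real.pi * (n + 1) * u : ℂ) * Complex.I_sq
  -- All frequencies `2πn` exceed `1`, so dividing by their powers preserves the summability at `z`.
  · have hs := (hf.hasSum ⟨z, hz⟩).summable.norm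
    refine Summable.of_nonneg_of_le (fun n => by positivity) (fun n => ?_) hs
    refine div_le_self (norm_nonneg _) (Real.one_le_rpow ?_ (by rw [hre]; linarith))
    have h1 : (1 : ℝ) ≤ ((n + 1 : ℕ) : ℝ) := by simp
    nlinarith [Real.pi_gt_three]

/-! ### The period integral on the vertical line over the cusp -/

theorem integrableOn_abs_sub_rpow (y : ℝ) {e : ℝ} (he : -1 < e) :
    IntegrableOn (fun t : ℝ => |t - y| ^ e) (Icc (y - 1) (y + 1)) := by
  have h := intervalIntegral.intervalIntegrable_rpow' (a := 0) (b := 1) he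
  have h1 := h.comp_sub_left y
  have h2 := h.comp_sub_right y
  rw [sub_zero] at h1
  rw [zero_add, add_comm] at h2
  have h1' := (intervalIntegrable_iff_integrableOn_Icc_of_le (by linarith)).1 h1.symm
  have h2' := (intervalIntegrable_iff_integrableOn_Icc_of_le (by linarith)).1 h2
  rw [← Icc_union_Icc_eq_Icc (show y - 1 ≤ y by linarith) (show y ≤ y + 1 by linarith)]
  refine IntegrableOn.union (h1'.congr_fun (fun t ht => ?_) measurableSet_Icc)
    (h2'.congr_fun (fun t ht => ?_) measurableSet_Icc)
  · change (y - t) ^ e = |t - y| ^ e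
    rw [abs_sub_comm, abs_of_nonneg (by linarith [ht.2])]
  · change (t - y) ^ e = |t - y| ^ e
    rw [abs_of_nonneg (by linarith [ht.1])]

/-- Dominating function for the limit onto the vertical line. Near `t = y` the singularity is
integrable because `e > -1`; elsewhere both powers grow at most like `(1 + t)^|e|`, leaving `(1 +
t)⁻²`. -/
theorem integrableOn_singular_bound {y e : ℝ} (hy : 0 < y) (he : -1 < e) :
    IntegrableOn (fun t : ℝ => (1 + t) ^ (-(|e| + 2)) * (|t - y| ^ e + (|t - y| + 1) ^ e))
      (Ioi 0) := by
  have hD : ∀ t : ℝ, 0 < t → ∀ w, 1 ≤ w → w ≤ (1 + y) * (1 + t) →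
      (1 + t) ^ (-(|e| + 2)) * w ^ e ≤ (1 ^ e + (1 + y) ^ e) * (1 + t) ^ (-2 : ℝ) := by
    intro t ht w h1 h2
    have h3 := rpow_le_mul_one_add_rpow e one_pos (by linarith) ht.le h1 h2
    calc _ ≤ (1 + t) ^ (-(|e| + 2)) * ((1 ^ e + (1 + y) ^ e) * (1 + t) ^ |e|) := by gcongr
      _ = (1 ^ e + (1 + y) ^ e) * ((1 + t) ^ (-(|e| + 2)) * (1 + t) ^ |e|) := by ring
      _ = _ := by
        rw [← Real.rpow_add (by linarith)]
        congr 2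
        ring
  have hle : ∀ t : ℝ, 0 < t → |t - y| ≤ t + y := fun t ht => by
    rw [abs_le]; constructor <;> linarith
  set D := 1 ^ e + (1 + y) ^ e with hDdef
  have hD0 : 0 ≤ D := by positivity
  have hint : Integrable (fun t : ℝ => 2 * D * (1 + t) ^ (-2 : ℝ) +
      (Icc (y - 1) (y + 1)).indicator (fun t : ℝ => |t - y| ^ e) t) (volume.restrict (Ioi 0)) :=
    (integrableOn_one_add_rpow (2 * D)).add
      (((integrableOn_abs_sub_rpow y he).integrable_indicator measurableSet_Icc).integrableOn)
  refine Integrable.mono' hint (by fun_prop) ?_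
  refine (ae_restrict_iff' measurableSet_Ioi).2 (ae_of_all _ fun t ht => ?_)
  rw [mem_Ioi] at ht
  have h1 := hD t ht (|t - y| + 1) (by linarith [abs_nonneg (t - y)]) (by nlinarith [hle t ht])
  rw [Real.norm_of_nonneg (by positivity), mul_add]
  by_cases hc : t ∈ Icc (y - 1) (y + 1)
  · rw [indicator_of_mem hc]
    have h2 : (1 + t) ^ (-(|e| + 2)) ≤ 1 := Real.rpow_le_one_of_one_le_of_nonpos (by linarith)
      (by linarith [abs_nonneg e])
    have h3 : (1 + t) ^ (-(|e| + 2)) * |t - y| ^ e ≤ |t - y| ^ e :=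
      mul_le_of_le_one_left (by positivity) h2
    have h4 : 0 ≤ D * (1 + t) ^ (-2 : ℝ) := by positivity
    linarith
  · rw [indicator_of_notMem hc]
    have h2 : 1 ≤ |t - y| := by
      by_contra! h
      rw [abs_lt] at h
      exact hc ⟨by linarith, by linarith⟩
    have h3 := hD t ht |t - y| h2 (by nlinarith [hle t ht])
    linarith

theorem rpow_le_add_rpow {a w : ℝ} (e : ℝ) (ha : 0 < a) (h1 : a ≤ w) (h2 : w ≤ a + 1) :
    w ^ e ≤ a ^ e + (a + 1) ^ e := by
  have hae : 0 < a ^ e := Real.rpow_pos_of_pos ha _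
  have hae' : 0 < (a + 1) ^ e := Real.rpow_pos_of_pos (by linarith) _
  rcases le_total e 0 with he | he
  · linarith [Real.rpow_le_rpow_of_nonpos ha h1 he]
  · linarith [Real.rpow_le_rpow (ha.le.trans h1) h2 he]

theorem ray_zero (γ : SL(2, ℤ)) (t : ℝ) : ray γ 0 t = ⟨cuspPoint γ, t⟩ := by simp [ray]

/-- On the vertical line through the cusp the period integral is a limit of integrals along this
line. -/
theorem IsCuspForm.periodIntegral_vertical (hf : IsCuspForm N k f) (h4 : 4 ∣ N) (hk : 1 < k)
    (hγ : γ ∈ CongruenceSubgroup.Gamma0 N) (hc : γ 1 0 ≠ 0) {y : ℝ} (hy : 0 < y) :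
    IntegrableOn (fun t : ℝ => f (UpperHalfPlane.ofComplex ⟨cuspPoint γ, t⟩) *
      branchPow (γ 1 0) ((t - y : ℝ) * Complex.I) ((k - 2 : ℝ) : ℂ) * Complex.I) (Ioi 0) ∧
    periodIntegral k f γ ⟨cuspPoint γ, y⟩ =
      ∫ t in Ioi (0 : ℝ), f (UpperHalfPlane.ofComplex ⟨cuspPoint γ, t⟩) *
        branchPow (γ 1 0) ((t - y : ℝ) * Complex.I) ((k - 2 : ℝ) : ℂ) * Complex.I := by
  have hk0 : 0 < k := by linarith
  set s : ℝ := ((γ 1 0).sign : ℝ) with hs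
  have hss : s * s = 1 := sign_mul_sign hc
  have hsabs : |s| = 1 := by
    rw [← sq_eq_sq₀ (abs_nonneg _) zero_le_one, sq_abs, sq, hss, one_pow]
  set ε : ℕ → ℝ := fun n => 1 / ((n : ℝ) + 1) with hε
  have hε0 : ∀ n, 0 < ε n := fun n => by positivity
  have hε1 : ∀ n, ε n ≤ 1 := fun n => by
    rw [hε]; exact (div_le_one (by positivity)).2 (by simp)
  have hεlim : Tendsto ε atTop (𝓝 0) := tendsto_one_div_add_atTop_nhds_zero_nat
  -- Points shifted off the line in the direction of the cut, whose cuts therefore miss the vertical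
  -- ray.
  set w : ℕ → ℂ := fun n => ⟨cuspPoint γ + s * ε n, y⟩ with hw
  have hwray : ∀ n, w n ∈ rayDomain γ 0 := fun n => by
    refine Or.inl ?_
    simp only [hw, add_sub_cancel_left, zero_mul, add_zero, ← hs]
    rw [← mul_assoc, hss, one_mul]
    exact hε0 n
  have hwlim : Tendsto w atTop (𝓝 ⟨cuspPoint γ, y⟩) := by
    have h1 : Tendsto (fun n => ((cuspPoint γ + s * ε n : ℝ) : ℂ) + y * Complex.I) atTop
        (𝓝 (((cuspPoint γ + s * 0 : ℝ) : ℂ) + y * Complex.I)) :=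
      ((Complex.continuous_ofReal.tendsto _).comp
        (tendsto_const_nhds.add (hεlim.const_mul s))).add tendsto_const_nhds
    rw [mul_zero, add_zero, ← Complex.mk_eq_add_mul_I] at h1
    refine h1.congr fun n => (Complex.mk_eq_add_mul_I _ _).symm
  have hmem : (⟨cuspPoint γ, y⟩ : ℂ) ∈ cutPlane γ := (mem_cutPlane_iff hc).2 (Or.inl hy.ne')
  have hlim := ((hf.differentiableAt_periodIntegral h4 hk0 hγ hc hmem).continuousAt.tendsto).comp
    hwlim
  set G : ℕ → ℝ → ℂ := fun n t => periodIntegrand k f γ (w n) (ray γ 0 t) * Complex.I with hG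
  have hval : ∀ n, periodIntegral k f γ (w n) = ∫ t in Ioi (0 : ℝ), G n t := fun n => by
    rw [hf.periodIntegral_eq h4 hk0 hγ hc (hwray n)]
    simp [hG]
  have hint : ∀ n, IntegrableOn (G n) (Ioi 0) := fun n =>
    (hf.integrableOn_ray h4 hk0 hγ hc (hwray n)).mul_const _
  obtain ⟨C, hC0, hC⟩ := hf.cone_bound h4 hk0 hγ hc 0 (|k - 2| + 2) (by positivity)
  -- The distance from `τ` to `w n` lies between `|t - y|` and `|t - y| + 1`, as the shift is at
  -- most `1`.
  set b : ℝ → ℝ := fun t => C * ((1 + t) ^ (-(|k - 2| + 2)) *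
    (|t - y| ^ (k - 2) + (|t - y| + 1) ^ (k - 2))) with hb
  have hbint : IntegrableOn b (Ioi 0) :=
    (integrableOn_singular_bound hy (by linarith)).const_mul C
  have hsub : ∀ n t, ray γ 0 t - w n = ⟨-(s * ε n), t - y⟩ := fun n t => by
    rw [ray_zero]
    apply Complex.ext <;> simp [hw]
  have hae : ∀ᵐ t ∂volume.restrict (Ioi (0 : ℝ)), 0 < t ∧ t ≠ y := by
    refine (ae_restrict_iff' measurableSet_Ioi).2 ?_
    filter_upwards [compl_mem_ae_iff.2 (measure_singleton y)] with t ht ht0 using ⟨ht0, ht⟩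
  have hbound : ∀ n, ∀ᵐ t ∂volume.restrict (Ioi (0 : ℝ)), ‖G n t‖ ≤ b t := fun n => by
    filter_upwards [hae] with t ht
    have h1 := hC t ht.1 (cuspPoint γ) (by simp)
    have h2 : 0 < |t - y| := abs_pos.2 (sub_ne_zero.2 ht.2)
    have h3 : |t - y| ≤ ‖ray γ 0 t - w n‖ := by
      rw [hsub]; exact Complex.abs_im_le_norm ⟨-(s * ε n), t - y⟩
    have h5 : ‖ray γ 0 t - w n‖ ≤ |t - y| + 1 := by
      rw [hsub]
      refine (Complex.norm_le_abs_re_add_abs_im _).trans ?_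
      simp only [abs_neg, abs_mul, hsabs, one_mul, abs_of_pos (hε0 n)]
      linarith [hε1 n]
    simp only [hG, periodIntegrand, norm_mul, Complex.norm_I, mul_one, norm_branchPow, hb]
    rw [← mul_assoc]
    rw [← ray_zero] at h1
    exact mul_le_mul h1 (rpow_le_add_rpow _ h2 h3 h5) (by positivity) (by
      have : 0 < 1 + t := by linarith
      positivity)
  have hpt : ∀ᵐ t ∂volume.restrict (Ioi (0 : ℝ)), Tendsto (fun n => G n t) atTop
      (𝓝 (f (UpperHalfPlane.ofComplex ⟨cuspPoint γ, t⟩) *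
        branchPow (γ 1 0) ((t - y : ℝ) * Complex.I) ((k - 2 : ℝ) : ℂ) * Complex.I)) := by
    filter_upwards [hae] with t ht
    simp only [hG, periodIntegrand, ray_zero]
    refine (tendsto_const_nhds.mul ?_).mul_const _
    have h1 : (⟨cuspPoint γ, t⟩ : ℂ) ∉ branchCut (γ 1 0) ⟨cuspPoint γ, y⟩ := fun h =>
      ht.2 ((mem_branchCut_iff hc).1 h).1
    have h2 := (hasDerivAt_branchPow hc ((k - 2 : ℝ) : ℂ)
      ((notMem_branchCut_iff hc).1 h1)).continuousAt.tendsto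
    have h3 : ((⟨cuspPoint γ, t⟩ : ℂ) - ⟨cuspPoint γ, y⟩) = (t - y : ℝ) * Complex.I := by
      apply Complex.ext <;> simp
    rw [h3] at h2
    refine h2.comp ?_
    rw [← h3]
    exact tendsto_const_nhds.sub hwlim
  refine ⟨Integrable.mono' hbint (aestronglyMeasurable_of_tendsto_ae atTop
    (fun n => (hint n).aestronglyMeasurable) hpt) ?_, ?_⟩
  · filter_upwards [hpt, ae_all_iff.2 hbound] with t h1 h2
    exact le_of_tendsto h1.norm (Eventually.of_forall h2)
  · have h5 := tendsto_integral_of_dominated_convergence b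
      (fun n => (hint n).aestronglyMeasurable) hbint hbound hpt
    refine tendsto_nhds_unique (hlim.congr fun n => ?_) h5
    exact hval n

theorem setIntegral_branchPow_above (f : UpperHalfPlane → ℂ) (c : ℤ) (x₀ y : ℝ) (e : ℂ) :
    ∫ t in Ioi y, f (UpperHalfPlane.ofComplex ⟨x₀, t⟩) *
        branchPow c ((t - y : ℝ) * Complex.I) e * Complex.I =
      Complex.exp (Real.pi * Complex.I * e / 2) * Complex.I * ∫ u in Ioi (0 : ℝ), ((u : ℝ) : ℂ) ^ e *
        f (UpperHalfPlane.ofComplex ((⟨x₀, y⟩ : ℂ) + u * Complex.I)) := by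
  rw [← (measurePreserving_add_right volume y).setIntegral_preimage_emb
    (measurableEmbedding_addRight y), ← integral_const_mul]
  have : (fun x => x + y) ⁻¹' Ioi y = Ioi (0 : ℝ) := by ext; simp
  rw [this]
  refine setIntegral_congr_fun measurableSet_Ioi fun u hu => ?_
  have h1 : (⟨x₀, u + y⟩ : ℂ) = (⟨x₀, y⟩ : ℂ) + u * Complex.I := by
    apply Complex.ext <;> simp [add_comm]
  simp only [add_sub_cancel_right]
  rw [branchPow_mul_I hu, h1]
  ring

theorem setIntegral_branchPow_below (f : UpperHalfPlane → ℂ) {c : ℤ} (hc : c ≠ 0) (x₀ y : ℝ)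
    (e : ℂ) :
    ∫ t in Ioo 0 y, f (UpperHalfPlane.ofComplex ⟨x₀, t⟩) *
        branchPow c ((t - y : ℝ) * Complex.I) e * Complex.I =
      Complex.exp (c.sign * (Real.pi * Complex.I * e) + Real.pi * Complex.I * e / 2) * Complex.I *
        ∫ t in Ioo 0 y, ((y - t : ℝ) : ℂ) ^ e * f (UpperHalfPlane.ofComplex ⟨x₀, t⟩) := by
  rw [← integral_const_mul]
  refine setIntegral_congr_fun measurableSet_Ioo fun t ht => ?_
  have h1 : ((t - y : ℝ) : ℂ) * Complex.I = -((y - t : ℝ) * Complex.I) := by push_cast; ring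
  rw [h1, branchPow_neg_mul_I (sub_pos.2 ht.2) hc]
  ring

theorem setIntegral_Ioi_split {g : ℝ → ℂ} {a y : ℝ} (hg : IntegrableOn g (Ioi a)) (hy : a ≤ y) :
    ∫ t in Ioi a, g t = (∫ t in Ioo a y, g t) + ∫ t in Ioi y, g t := by
  rw [← Ioc_union_Ioi_eq_Ioi hy, setIntegral_union Ioc_disjoint_Ioi_same measurableSet_Ioi
    (hg.mono_set fun t ht => ht.1) (hg.mono_set fun t ht => hy.trans_lt ht),
    integral_Ioc_eq_integral_Ioo]

/-- The part above `z` will give `f̃(z)`, the part below the slashed term; the relative phase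
`exp(sign(c)πi(k-2))` records on which side the branch passes around `z`. -/
theorem IsCuspForm.periodIntegral_split (hf : IsCuspForm N k f) (h4 : 4 ∣ N) (hk : 1 < k)
    (hγ : γ ∈ CongruenceSubgroup.Gamma0 N) (hc : γ 1 0 ≠ 0) {y : ℝ} (hy : 0 < y) :
    periodIntegral k f γ ⟨cuspPoint γ, y⟩ =
      Complex.exp (Real.pi * Complex.I * ((k - 2 : ℝ) : ℂ) / 2) * Complex.I *
      ((∫ u in Ioi (0 : ℝ), ((u : ℝ) : ℂ) ^ ((k - 2 : ℝ) : ℂ) *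
        f (UpperHalfPlane.ofComplex ((⟨cuspPoint γ, y⟩ : ℂ) + u * Complex.I))) +
      Complex.exp ((γ 1 0).sign * (Real.pi * Complex.I * ((k - 2 : ℝ) : ℂ))) *
        ∫ t in Ioo 0 y, ((y - t : ℝ) : ℂ) ^ ((k - 2 : ℝ) : ℂ) *
          f (UpperHalfPlane.ofComplex ⟨cuspPoint γ, t⟩)) := by
  obtain ⟨h1, h2⟩ := hf.periodIntegral_vertical h4 hk hγ hc hy
  rw [h2, setIntegral_Ioi_split h1 hy.le, setIntegral_branchPow_above, setIntegral_branchPow_below _ hc,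
    Complex.exp_add]
  ring

/-! ### The slashed Eichler integral on the vertical line -/

theorem sign_mul_I_cpow {c : ℤ} (hc : c ≠ 0) (e : ℂ) :
    ((c.sign : ℂ) * Complex.I) ^ e = Complex.exp (c.sign * (Real.pi * Complex.I * e / 2)) := by
  rcases lt_or_gt_of_ne hc with h | h
  · rw [Int.sign_eq_neg_one_of_neg h]
    simpa using neg_I_cpow e
  · rw [Int.sign_eq_one_of_pos h]
    simpa using I_cpow e

/-- On this line `cz + d = |c| t · sign(c) i`, with principal argument `sign(c)π/2`. -/
theorem autFactor_vertical_cpow (hc : γ 1 0 ≠ 0) {t : ℝ} (ht : 0 < t) (e : ℂ) :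
    autFactor γ ⟨cuspPoint γ, t⟩ ^ e = ((|(γ 1 0 : ℝ)| * t : ℝ) : ℂ) ^ e *
      Complex.exp ((γ 1 0).sign * (Real.pi * Complex.I * e / 2)) := by
  have h1 : autFactor γ ⟨cuspPoint γ, t⟩ =
      ((|(γ 1 0 : ℝ)| * t : ℝ) : ℂ) * (((γ 1 0).sign : ℂ) * Complex.I) := by
    rw [autFactor_eq hc]
    have h2 : (⟨cuspPoint γ, t⟩ : ℂ) - cuspPoint γ = t * Complex.I := by
      apply Complex.ext <;> simp
    have h3 : ((γ 1 0 : ℤ) : ℂ) = ((|(γ 1 0 : ℝ)| : ℝ) : ℂ) * ((γ 1 0).sign : ℂ) := by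
      rw [← Int.cast_abs, Complex.ofReal_intCast, ← Int.cast_mul, mul_comm, Int.sign_mul_abs]
    rw [h2]
    nth_rewrite 1 [h3]
    push_cast
    ring
  have hpos : 0 < |(γ 1 0 : ℝ)| * t := mul_pos (abs_pos.2 (by exact_mod_cast hc)) ht
  rw [h1, ofReal_mul_cpow hpos (mul_ne_zero (by simpa using hc) Complex.I_ne_zero),
    sign_mul_I_cpow hc]

/-- The line over `-d/c` goes to the line over `a/c` by `t ↦ 1/(c² t)`, reversing direction, so the
integral upward from `γz` pulls back to one from `z` down to the cusp. -/
theorem coe_smul_vertical (hc : γ 1 0 ≠ 0) {t : ℝ} (ht : 0 < t) :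
    ((γ • (⟨⟨cuspPoint γ, t⟩, ht⟩ : UpperHalfPlane) : UpperHalfPlane) : ℂ) =
      (γ 0 0 : ℂ) / (γ 1 0 : ℂ) + ((t⁻¹ / (γ 1 0 : ℝ) ^ 2 : ℝ) : ℂ) * Complex.I := by
  have hc' : (γ 1 0 : ℂ) ≠ 0 := by exact_mod_cast hc
  have ht' : (t : ℂ) ≠ 0 := by exact_mod_cast ht.ne'
  have hdet : (γ 0 0 : ℂ) * γ 1 1 - γ 0 1 * γ 1 0 = 1 := by exact_mod_cast det_eq_one γ
  rw [coe_smul_eq, autFactor_eq hc]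
  change ((γ 0 0 : ℂ) * (⟨cuspPoint γ, t⟩ : ℂ) + _) / (_ * ((⟨cuspPoint γ, t⟩ : ℂ) - _)) = _
  rw [Complex.mk_eq_add_mul_I, add_sub_cancel_left]
  simp only [cuspPoint]
  push_cast
  field_simp [Complex.I_ne_zero]
  linear_combination (-1 : ℂ) * hdet - Complex.I_sq

/-- The reason for the twist by `χ_{-4}`: the exponents differ by `4k - 4 = 4n - 2`, and `i^{4n-2} =
-1`. -/
theorem epsilonFactor_identity {d : ℤ} (hd : d % 2 = 1) {n : ℕ} (hkn : k = 1 / 2 + n) :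
    (kronecker (-4) d : ℂ) * epsilonFactor d ^ ((2 * (2 - k) : ℝ) : ℂ) =
      epsilonFactor d ^ ((2 * k : ℝ) : ℂ) := by
  rw [kronecker_neg_four hd, epsilonFactor]
  split_ifs with h
  · simp
  · rw [I_cpow, I_cpow]
    have h1 : Real.pi * Complex.I * ((2 * k : ℝ) : ℂ) / 2 =
        Real.pi * Complex.I * ((2 * (2 - k) : ℝ) : ℂ) / 2 + Real.pi * Complex.I +
          ((n : ℤ) - 1 : ℤ) * (2 * Real.pi * Complex.I) := by
      rw [hkn]; push_cast; ring
    rw [h1, Complex.exp_add, Complex.exp_add, Complex.exp_int_mul_two_pi_mul_I, Complex.exp_pi_mul_I]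
    push_cast
    ring

/-- The absolute values in the substitution `φ(t) = (1/t - 1/y)/c²`: one has `φ = (y - t)/(|c|y ·
|c|t)` and `|φ'| = (|c|t)⁻²`. -/
theorem rpow_identity {c y t : ℝ} (hc : c ≠ 0) (ht : 0 < t) (hty : t < y) (k : ℝ) :
    (|c| * y) ^ (k - 2) * ((t ^ 2)⁻¹ / c ^ 2 * ((t⁻¹ - y⁻¹) / c ^ 2) ^ (k - 2)) =
      (y - t) ^ (k - 2) * (|c| * t) ^ (-k) := by
  have hy : 0 < y := ht.trans hty
  have hc' : 0 < |c| := abs_pos.2 hc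
  have hφ : (t⁻¹ - y⁻¹) / c ^ 2 = (y - t) / ((|c| * y) * (|c| * t)) := by
    rw [← sq_abs c]
    field_simp
  have h2 : (t ^ 2)⁻¹ / c ^ 2 = (|c| * t) ^ (-2 : ℝ) := by
    rw [← sq_abs c, Real.rpow_neg (by positivity), Real.rpow_two]
    field_simp
  have hyt : 0 < y - t := sub_pos.2 hty
  rw [h2, hφ, Real.div_rpow hyt.le (by positivity),
    Real.mul_rpow (x := |c| * y) (y := |c| * t) (by positivity) (by positivity)]
  have h3 : (|c| * t) ^ (-k) = (|c| * t) ^ (-2 : ℝ) / (|c| * t) ^ (k - 2) := by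
    rw [← Real.rpow_sub (by positivity)]; ring_nf
  have h4 : (|c| * y) ^ (k - 2) ≠ 0 := (Real.rpow_pos_of_pos (by positivity) _).ne'
  have h5 : (|c| * t) ^ (k - 2) ≠ 0 :=
    (Real.rpow_pos_of_pos (mul_pos hc' ht) _).ne'
  rw [h3]
  generalize (|c| * y) ^ (k - 2) = a at *
  generalize (|c| * t) ^ (k - 2) = b at *
  generalize (|c| * t) ^ (-2 : ℝ) = w
  field_simp

/-- Substitution `u = (1/t - 1/y) / c²`. -/
theorem setIntegral_substitution {c y : ℝ} (hc : c ≠ 0) (hy : 0 < y) (g : ℝ → ℂ) :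
    ∫ u in Ioi (0 : ℝ), g u =
      ∫ t in Ioo 0 y, (((t ^ 2)⁻¹ / c ^ 2 : ℝ) : ℂ) * g ((t⁻¹ - y⁻¹) / c ^ 2) := by
  have hc2 : 0 < c ^ 2 := by positivity
  have himage : (fun t : ℝ => (t⁻¹ - y⁻¹) / c ^ 2) '' Ioo 0 y = Ioi 0 := by
    ext u
    constructor
    · rintro ⟨t, ht, rfl⟩
      exact div_pos (sub_pos.2 ((inv_lt_inv₀ hy ht.1).2 ht.2)) hc2
    · intro hu
      rw [mem_Ioi] at hu
      have h1 : y⁻¹ < c ^ 2 * u + y⁻¹ := by linarith [mul_pos hc2 hu]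
      have h2 : 0 < y⁻¹ := inv_pos.2 hy
      refine ⟨(c ^ 2 * u + y⁻¹)⁻¹, ⟨inv_pos.2 (h2.trans h1), ?_⟩, ?_⟩
      · rw [inv_lt_comm₀ (h2.trans h1) hy]; exact h1
      · simp only [inv_inv, add_sub_cancel_right]
        field_simp
  have hinj : InjOn (fun t : ℝ => (t⁻¹ - y⁻¹) / c ^ 2) (Ioo 0 y) := fun a _ b _ hab => by
    have := (div_left_inj' hc2.ne').1 hab
    exact inv_injective (sub_left_injective this)
  rw [← himage, integral_image_eq_integral_abs_deriv_smul measurableSet_Ioo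
    (f' := fun t => -(t ^ 2)⁻¹ / c ^ 2) (fun t ht =>
      (((hasDerivAt_inv ht.1.ne').sub_const _).div_const _).hasDerivWithinAt) hinj]
  refine setIntegral_congr_fun measurableSet_Ioo fun t ht => ?_
  simp only [Complex.real_smul]
  rw [neg_div, abs_neg, abs_of_pos (div_pos (inv_pos.2 (pow_pos ht.1 2)) hc2)]

/-- The slash of the Eichler integral, on the vertical line through the cusp. -/
theorem IsCuspForm.slash_eichlerIntegral_vertical (hf : IsCuspForm N k f) (h4 : 4 ∣ N) {n : ℕ}
    (hkn : k = 1 / 2 + n) (hk : 1 < k)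
    (hγ : γ ∈ CongruenceSubgroup.Gamma0 N) (hc : γ 1 0 ≠ 0) {y : ℝ} (hy : 0 < y) :
    (kronecker (-4) (γ 1 1) : ℂ) * slash (2 - k) γ (eichlerIntegral k f) ⟨⟨cuspPoint γ, y⟩, hy⟩ =
      ((2 * Real.pi : ℝ) : ℂ) ^ ((k - 1 : ℝ) : ℂ) / Complex.Gamma (k - 1) *
      -(Complex.exp ((γ 1 0).sign * (Real.pi * Complex.I * ((k - 2 : ℝ) : ℂ))) *
        ∫ t in Ioo 0 y, ((y - t : ℝ) : ℂ) ^ ((k - 2 : ℝ) : ℂ) *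
          f (UpperHalfPlane.ofComplex ⟨cuspPoint γ, t⟩)) := by
  set z : UpperHalfPlane := ⟨⟨cuspPoint γ, y⟩, hy⟩ with hz
  have hcR : (γ 1 0 : ℝ) ≠ 0 := by exact_mod_cast hc
  set s : ℂ := ((γ 1 0).sign : ℂ) with hs
  set A : ℂ := (kronecker (-4) (γ 1 1) : ℂ) * (epsilonFactor (γ 1 1) ^ ((2 * (2 - k) : ℝ) : ℂ) *
    (kronecker (γ 1 0) (γ 1 1) : ℂ) * autFactor γ z ^ ((-(2 - k) : ℝ) : ℂ)) with hA
  -- After the substitution, `γz + iu` is `γ` of a point on the original line, and modularity turns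
  -- `f` there into `f` at that point.
  have key : A * ∫ u in Ioi (0 : ℝ), ((u : ℝ) : ℂ) ^ ((k - 2 : ℝ) : ℂ) *
      f (UpperHalfPlane.ofComplex (((γ • z : UpperHalfPlane) : ℂ) + u * Complex.I)) =
      -(Complex.exp (s * (Real.pi * Complex.I * ((k - 2 : ℝ) : ℂ))) *
        ∫ t in Ioo 0 y, ((y - t : ℝ) : ℂ) ^ ((k - 2 : ℝ) : ℂ) *
          f (UpperHalfPlane.ofComplex ⟨cuspPoint γ, t⟩)) := by
    rw [setIntegral_substitution hcR hy, ← integral_const_mul, ← integral_const_mul, ← integral_neg]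
    refine setIntegral_congr_fun measurableSet_Ioo fun t ht => ?_
    have hpt : ((γ • z : UpperHalfPlane) : ℂ) +
        (((t⁻¹ - y⁻¹) / (γ 1 0 : ℝ) ^ 2 : ℝ) : ℂ) * Complex.I =
        ((γ • (⟨⟨cuspPoint γ, t⟩, ht.1⟩ : UpperHalfPlane) : UpperHalfPlane) : ℂ) := by
      rw [coe_smul_vertical hc hy, coe_smul_vertical hc ht.1]
      push_cast
      ring
    have hφ : 0 < (t⁻¹ - y⁻¹) / (γ 1 0 : ℝ) ^ 2 :=
      div_pos (sub_pos.2 ((inv_lt_inv₀ hy ht.1).2 ht.2)) (by positivity)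
    -- Matching of phases: that of `(cz + d)^{k-2}` against the branch factor below `z` times that
    -- of `(cτ + d)^{-k}`. They differ by `e^{±πi} = -1`, the sign that turns the difference in the
    -- obstruction into a sum of two integrals.
    have hexp : Complex.exp (s * (Real.pi * Complex.I * ((k - 2 : ℝ) : ℂ) / 2)) =
        -(Complex.exp (s * (Real.pi * Complex.I * ((k - 2 : ℝ) : ℂ))) *
          Complex.exp (s * (Real.pi * Complex.I * ((-k : ℝ) : ℂ) / 2))) := by
      have h1 : s * (Real.pi * Complex.I * ((k - 2 : ℝ) : ℂ) / 2) =
          s * (Real.pi * Complex.I * ((k - 2 : ℝ) : ℂ)) +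
          s * (Real.pi * Complex.I * ((-k : ℝ) : ℂ) / 2) + s * (Real.pi * Complex.I) := by
        push_cast; ring
      have h2 : Complex.exp (s * (Real.pi * Complex.I)) = -1 := by
        rcases lt_or_gt_of_ne hc with h | h
        · rw [hs, Int.sign_eq_neg_one_of_neg h]
          simp [Complex.exp_neg, Complex.exp_pi_mul_I]
        · rw [hs, Int.sign_eq_one_of_pos h]
          simp [Complex.exp_pi_mul_I]
      rw [h1, Complex.exp_add, Complex.exp_add, h2]
      ring
    have hreal : ((|(γ 1 0 : ℝ)| * y : ℝ) : ℂ) ^ ((k - 2 : ℝ) : ℂ) *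
        ((((t ^ 2)⁻¹ / (γ 1 0 : ℝ) ^ 2 : ℝ) : ℂ) *
          (((t⁻¹ - y⁻¹) / (γ 1 0 : ℝ) ^ 2 : ℝ) : ℂ) ^ ((k - 2 : ℝ) : ℂ)) =
        ((y - t : ℝ) : ℂ) ^ ((k - 2 : ℝ) : ℂ) *
          ((|(γ 1 0 : ℝ)| * t : ℝ) : ℂ) ^ ((-k : ℝ) : ℂ) := by
      have hyt : 0 ≤ y - t := (sub_pos.2 ht.2).le
      have hct : 0 ≤ |(γ 1 0 : ℝ)| * t := mul_nonneg (abs_nonneg _) ht.1.le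
      rw [← Complex.ofReal_cpow (by positivity), ← Complex.ofReal_cpow hφ.le,
        ← Complex.ofReal_cpow hyt, ← Complex.ofReal_cpow hct, ← Complex.ofReal_mul,
        ← Complex.ofReal_mul, ← Complex.ofReal_mul, rpow_identity hcR ht.1 ht.2]
    rw [hpt, UpperHalfPlane.ofComplex_apply, ofComplex_mk ht.1,
      hf.slash_eq γ hγ ⟨⟨cuspPoint γ, t⟩, ht.1⟩, slash, hA, ← mul_assoc (kronecker (-4) (γ 1 1) : ℂ),
      ← mul_assoc (kronecker (-4) (γ 1 1) : ℂ),
      epsilonFactor_identity (odd_of_mem_Gamma0 h4 hγ) hkn]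
    have hz' : ((z : UpperHalfPlane) : ℂ) = ⟨cuspPoint γ, y⟩ := rfl
    have ht' : (((⟨⟨cuspPoint γ, t⟩, ht.1⟩ : UpperHalfPlane)) : ℂ) = ⟨cuspPoint γ, t⟩ := rfl
    rw [hz', ht', autFactor_vertical_cpow hc hy, autFactor_vertical_cpow hc ht.1, neg_sub, ← hs,
      hexp]
    linear_combination (-(epsilonFactor (γ 1 1) ^ ((2 * k : ℝ) : ℂ) *
      (kronecker (γ 1 0) (γ 1 1) : ℂ) *
      (Complex.exp (s * (Real.pi * Complex.I * ((k - 2 : ℝ) : ℂ))) *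
          Complex.exp (s * (Real.pi * Complex.I * ((-k : ℝ) : ℂ) / 2))) *
      f (γ • (⟨⟨cuspPoint γ, t⟩, ht.1⟩ : UpperHalfPlane)))) * hreal
  rw [← key, slash, eichlerIntegral_eq, hf.eichlerSeries_eq_integral hk (γ • z).im_pos, hA]
  ring

/-- The three arguments `-π(k-1)/2`, `π(k-2)/2` and `π/2` add up to zero. -/
theorem period_constant (k : ℝ) :
    (-2 * Real.pi * Complex.I) ^ ((k - 1 : ℝ) : ℂ) *
      (Complex.exp (Real.pi * Complex.I * ((k - 2 : ℝ) : ℂ) / 2) * Complex.I) =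
      ((2 * Real.pi : ℝ) : ℂ) ^ ((k - 1 : ℝ) : ℂ) := by
  have h1 : (-2 * Real.pi * Complex.I : ℂ) = ((2 * Real.pi : ℝ) : ℂ) * (-Complex.I) := by
    push_cast; ring
  rw [h1, ofReal_mul_cpow (by positivity) (neg_ne_zero.2 Complex.I_ne_zero), neg_I_cpow]
  have hI : Complex.exp (Real.pi * Complex.I * ((k - 2 : ℝ) : ℂ) / 2) * Complex.I =
      Complex.exp (Real.pi * Complex.I * ((k - 2 : ℝ) : ℂ) / 2 + Real.pi / 2 * Complex.I) := by
    rw [Complex.exp_add, Complex.exp_pi_div_two_mul_I]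
  rw [hI, mul_assoc, ← Complex.exp_add]
  have h2 : -(Real.pi * Complex.I * ((k - 1 : ℝ) : ℂ) / 2) +
      (Real.pi * Complex.I * ((k - 2 : ℝ) : ℂ) / 2 + Real.pi / 2 * Complex.I) = 0 := by
    push_cast; ring
  rw [h2, Complex.exp_zero, mul_one]

/-! ### Comparison on the upper half-plane and conclusion -/

theorem IsCuspForm.obstruction_vertical (hf : IsCuspForm N k f) (h4 : 4 ∣ N) {n : ℕ}
    (hkn : k = 1 / 2 + n) (hk : 1 < k)
    (hγ : γ ∈ CongruenceSubgroup.Gamma0 N) (hc : γ 1 0 ≠ 0) {y : ℝ} (hy : 0 < y) :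
    (-2 * Real.pi * Complex.I) ^ ((k - 1 : ℝ) : ℂ) / Complex.Gamma (k - 1) *
      periodIntegral k f γ ⟨cuspPoint γ, y⟩ = obstruction k f γ ⟨⟨cuspPoint γ, y⟩, hy⟩ := by
  rw [obstruction, hf.slash_eichlerIntegral_vertical h4 hkn hk hγ hc hy,
    hf.periodIntegral_split h4 hk hγ hc hy, eichlerIntegral_eq,
    hf.eichlerSeries_eq_integral hk hy, ← period_constant k]
  change _ = _ / _ * (∫ u in Ioi (0 : ℝ), ((u : ℝ) : ℂ) ^ ((k - 2 : ℝ) : ℂ) *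
        f (UpperHalfPlane.ofComplex ((⟨cuspPoint γ, y⟩ : ℂ) + u * Complex.I))) - _
  ring

theorem IsCuspForm.differentiableOn_obstruction (hf : IsCuspForm N k f) (hk : 1 ≤ k)
    (hc : γ 1 0 ≠ 0) :
    DifferentiableOn ℂ (fun τ => obstruction k f γ (UpperHalfPlane.ofComplex τ))
      {τ | 0 < τ.im} := by
  have hE := hf.differentiableOn_eichlerSeries hk
  have haut : Differentiable ℂ (autFactor γ) := by unfold autFactor; fun_prop
  have hopen : IsOpen {τ : ℂ | 0 < τ.im} := isOpen_lt continuous_const Complex.continuous_im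
  have hmaps : ∀ (τ : ℂ) (hτ : 0 < τ.im),
      0 < (((γ 0 0 : ℂ) * τ + γ 0 1) / autFactor γ τ).im := fun τ hτ => by
    have := (γ • (⟨τ, hτ⟩ : UpperHalfPlane)).im_pos
    rwa [← UpperHalfPlane.coe_im, coe_smul_eq] at this
  have hne : ∀ (τ : ℂ) (hτ : 0 < τ.im), autFactor γ τ ≠ 0 := fun τ hτ =>
    autFactor_ne_zero γ ⟨τ, hτ⟩
  have hslit : ∀ (τ : ℂ) (hτ : 0 < τ.im), autFactor γ τ ∈ Complex.slitPlane := fun τ hτ =>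
    (mem_cutPlane_iff hc).2 (Or.inl hτ.ne')
  have hslash : DifferentiableOn ℂ (fun τ => epsilonFactor (γ 1 1) ^ ((2 * (2 - k) : ℝ) : ℂ) *
      (kronecker (γ 1 0) (γ 1 1) : ℂ) * autFactor γ τ ^ ((-(2 - k) : ℝ) : ℂ) *
      eichlerSeries k f (((γ 0 0 : ℂ) * τ + γ 0 1) / autFactor γ τ)) {τ | 0 < τ.im} := by
    intro τ hτ
    have h1 : DifferentiableAt ℂ (fun τ => autFactor γ τ ^ ((-(2 - k) : ℝ) : ℂ)) τ :=
      (haut τ).cpow_const (hslit τ hτ)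
    have h2 : DifferentiableAt ℂ (fun τ => ((γ 0 0 : ℂ) * τ + γ 0 1) / autFactor γ τ) τ :=
      DifferentiableAt.div (by fun_prop) (haut τ) (hne τ hτ)
    have h3 : DifferentiableAt ℂ (fun τ =>
        eichlerSeries k f (((γ 0 0 : ℂ) * τ + γ 0 1) / autFactor γ τ)) τ :=
      DifferentiableAt.comp (g := eichlerSeries k f) τ
        ((hE _ (hmaps τ hτ)).differentiableAt (hopen.mem_nhds (hmaps τ hτ))) h2
    exact ((h1.const_mul _).mul h3).differentiableWithinAt
  refine (hE.sub (hslash.const_mul (kronecker (-4) (γ 1 1) : ℂ))).congr fun τ hτ => ?_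
  simp only [Pi.sub_apply, obstruction, slash, eichlerIntegral_eq, coe_smul_eq,
    UpperHalfPlane.ofComplex_apply_of_im_pos hτ]

theorem IsCuspForm.periodIntegral_eq_obstruction (hf : IsCuspForm N k f) (h4 : 4 ∣ N) {n : ℕ}
    (hkn : k = 1 / 2 + n) (hk : 1 < k)
    (hγ : γ ∈ CongruenceSubgroup.Gamma0 N) (hc : γ 1 0 ≠ 0) (z : UpperHalfPlane) :
    (-2 * Real.pi * Complex.I) ^ ((k - 1 : ℝ) : ℂ) / Complex.Gamma (k - 1) *
      periodIntegral k f γ z = obstruction k f γ z := by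
  have hopen : IsOpen {τ : ℂ | 0 < τ.im} := isOpen_lt continuous_const Complex.continuous_im
  have hsub : {τ : ℂ | 0 < τ.im} ⊆ cutPlane γ := fun τ hτ =>
    (mem_cutPlane_iff hc).2 (Or.inl (ne_of_gt hτ))
  have h1 : AnalyticOnNhd ℂ (fun τ => (-2 * Real.pi * Complex.I) ^ ((k - 1 : ℝ) : ℂ) /
      Complex.Gamma (k - 1) * periodIntegral k f γ τ) {τ | 0 < τ.im} :=
    analyticOnNhd_const.mul ((hf.analyticOnNhd_periodIntegral h4 (by linarith) hγ hc).mono hsub)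
  have h2 := (hf.differentiableOn_obstruction (γ := γ) hk.le hc).analyticOnNhd hopen
  have hz₀ : (⟨cuspPoint γ, 1⟩ : ℂ) ∈ {τ : ℂ | 0 < τ.im} := zero_lt_one' ℝ
  -- The equality on the vertical line accumulates at `-d/c + i`, enough for the identity theorem on
  -- the connected upper half-plane.
  have hfreq : ∃ᶠ τ in 𝓝[≠] (⟨cuspPoint γ, 1⟩ : ℂ), (-2 * Real.pi * Complex.I) ^
      ((k - 1 : ℝ) : ℂ) / Complex.Gamma (k - 1) * periodIntegral k f γ τ =
      obstruction k f γ (UpperHalfPlane.ofComplex τ) := by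
    have ht : Tendsto (fun y : ℝ => (⟨cuspPoint γ, y⟩ : ℂ)) (𝓝[≠] 1)
        (𝓝[≠] (⟨cuspPoint γ, 1⟩ : ℂ)) := by
      refine tendsto_nhdsWithin_iff.2 ⟨Tendsto.mono_left ?_ nhdsWithin_le_nhds, ?_⟩
      · have : Continuous (fun y : ℝ => (⟨cuspPoint γ, y⟩ : ℂ)) := by
          simp_rw [Complex.mk_eq_add_mul_I]; fun_prop
        exact this.tendsto 1
      · filter_upwards [self_mem_nhdsWithin] with y hy h
        exact hy (congrArg Complex.im h)
    refine ht.frequently (Eventually.frequently ?_)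
    filter_upwards [nhdsWithin_le_nhds (Ioi_mem_nhds (zero_lt_one' ℝ))] with y hy
    rw [ofComplex_mk hy]
    exact hf.obstruction_vertical h4 hkn hk hγ hc hy
  have h3 := h1.eqOn_of_preconnected_of_frequently_eq h2
    (convex_halfSpace_im_gt 0).isPreconnected hz₀ hfreq z.im_pos
  simpa using h3

/-- For `c = 0` the obstruction vanishes wherever `cz + d` is not a negative real number. -/
theorem obstruction_eq_zero (hc : γ 1 0 = 0) {z : UpperHalfPlane} (hz : (z : ℂ) ∈ cutPlane γ) :
    obstruction k f γ z = 0 := by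
  have hdet := det_eq_one γ
  rw [hc, mul_zero, sub_zero] at hdet
  have hd : γ 1 1 = 1 := by
    -- Here `ad = 1`. The case `d = -1` has empty cut plane, so `γ` is an integer translation, under
    -- which `f̃` is invariant.
    rcases Int.eq_one_or_neg_one_of_mul_eq_one' hdet with h | h
    · exact h.2
    · have h1 : autFactor γ z ∈ Complex.slitPlane := hz
      simp [autFactor, hc, h.2, Complex.mem_slitPlane_iff] at h1
      linarith
  have ha : γ 0 0 = 1 := by rw [hd, mul_one] at hdet; exact hdet
  have h1 : ((γ • z : UpperHalfPlane) : ℂ) = z + (γ 0 1 : ℂ) := by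
    rw [coe_smul_eq]; simp [autFactor, hc, hd, ha]
  rw [obstruction, slash_of_eq_zero_of_eq_one _ hc hd, eichlerIntegral_eq, eichlerIntegral_eq, h1,
    eichlerSeries_add_int, hd, kronecker_neg_four (by norm_num)]
  simp

end HalfIntegral

theorem corollary1p2 (N : ℕ) (hN : 0 < N) (h4 : 4 ∣ N)
    (k : ℝ) (hk : ∃ n : ℕ, 1 ≤ n ∧ k = 1 / 2 + n)
    (f : UpperHalfPlane → ℂ) (hf : HalfIntegral.IsCuspForm N k f) :
    MDifferentiable 𝓘(ℂ) 𝓘(ℂ) (HalfIntegral.eichlerIntegral k f) ∧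
    ∀ γ ∈ CongruenceSubgroup.Gamma0 N, ∃ H : ℂ → ℂ,
      AnalyticOnNhd ℂ H (HalfIntegral.cutPlane γ) ∧
      (∀ z : UpperHalfPlane, (z : ℂ) ∈ HalfIntegral.cutPlane γ →
        H z = HalfIntegral.obstruction k f γ z) ∧
      (γ 1 0 ≠ 0 → ∀ z ∈ HalfIntegral.cutPlane γ,
        (∃ p : ℝ → ℂ, HalfIntegral.IsAdmissiblePath γ z p) ∧
        ∀ p : ℝ → ℂ, HalfIntegral.IsAdmissiblePath γ z p →
          ∃ J : ℂ, HalfIntegral.HasContourIntegral (HalfIntegral.periodIntegrand k f γ z) p J ∧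
            H z = (-2 * Real.pi * Complex.I) ^ ((k - 1 : ℝ) : ℂ) / Complex.Gamma (k - 1) * J) ∧
      (γ 1 0 = 0 → ∀ z ∈ HalfIntegral.cutPlane γ, H z = 0) := by
  obtain ⟨n, hn, hkn⟩ := hk
  -- The bound `k > 1` makes `u^{k-2}` integrable at `0`.
  have hk1 : 1 < k := by
    have : (1 : ℝ) ≤ n := by exact_mod_cast hn
    linarith
  have hk0 : 0 < k := by linarith
  refine ⟨hf.mdifferentiable_eichlerIntegral hk1.le, fun γ hγ => ?_⟩
  by_cases hc : γ 1 0 = 0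
  · refine ⟨fun _ => 0, analyticOnNhd_const, fun z hz => ?_, fun h => absurd hc h, fun _ _ _ => rfl⟩
    exact (HalfIntegral.obstruction_eq_zero hc hz).symm
  · refine ⟨fun z => (-2 * Real.pi * Complex.I) ^ ((k - 1 : ℝ) : ℂ) / Complex.Gamma (k - 1) *
      HalfIntegral.periodIntegral k f γ z,
      analyticOnNhd_const.mul (hf.analyticOnNhd_periodIntegral h4 hk0 hγ hc),
      fun z _ => hf.periodIntegral_eq_obstruction h4 hkn hk1 hγ hc z, fun _ z hz => ?_,
      fun h => absurd h hc⟩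
    exact ⟨HalfIntegral.exists_isAdmissiblePath hc hz, fun p hp =>
      ⟨_, hf.hasContourIntegral_periodIntegral h4 hk0 hγ hc hz hp, rfl⟩⟩
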